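/- Let $n\ge 2$. A \emph{pseudo-cone} in $\mathbb{R}^n$ is a nonempty convex set $K\subset\mathbb{R}^n$ with $o\notin K$ (where $o$ is the origin) such that $\lambda x\in K$ for all $x\in K$ and all real $\lambda\ge 1$. Let $\mathcal{PC}^n$ be the family consisting of all closed pseudo-cones in $\mathbb{R}^n$ together with $\emptyset$ and $\mathbb{R}^n$. Ordered by inclusion it is a lattice with operations $$K\wedge L=K\cap L,\qquad K\vee L=\begin{cases}\operatorname{cl}[K,L] & \text{if } o\notin\operatorname{cl}[K,L],\\ \mathbb{R}^n & \text{if } o\in\operatorname{cl}[K,L],\end{cases}$$ where $\operatorname{cl}[K,L]$ is the closure of the convex hull of $K\cup L$. Then a map $\varphi:\mathcal{PC}^n\to\mathcal{PC}^n$ satisfies $$\varphi(K\wedge L)=\varphi(K)\wedge\varphi(L)\quad\text{and}\quad \varphi(K\vee L)=\varphi(K)\vee\varphi(L)\qquad\text{for all }K,L\in\mathcal{PC}^n$$ if and only if either $\varphi$ is constant, or there is $g\in\mathrm{GL}(n)$ such that $\varphi(K)=gK=\{gx:x\in K\}$ for all $K\in\mathcal{PC}^n$. -/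

import Mathlib

/-- A pseudo-cone: a nonempty convex set, not containing the origin, that is closed under
multiplication by all scalars `c ≥ 1`. -/
structure IsPseudoCone {n : ℕ} (K : Set (EuclideanSpace ℝ (Fin n))) : Prop where
  nonempty : K.Nonempty
  convex : Convex ℝ K
  zero_notMem : (0 : EuclideanSpace ℝ (Fin n)) ∉ K
  smul_mem : ∀ x ∈ K, ∀ c : ℝ, 1 ≤ c → c • x ∈ K

/-- The closed pseudo-cones in `ℝⁿ`, together with the empty set and the whole space. -/
def PC (n : ℕ) : Type :=
  {K : Set (EuclideanSpace ℝ (Fin n)) //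
    (IsClosed K ∧ IsPseudoCone K) ∨ K = ∅ ∨ K = Set.univ}

namespace PC

variable {n : ℕ}

/-- The underlying subset of `ℝⁿ`. -/
def carrier (K : PC n) : Set (EuclideanSpace ℝ (Fin n)) := K.1

theorem carrier_injective : Function.Injective (carrier (n := n)) := Subtype.val_injective

theorem isClosed (K : PC n) : IsClosed K.carrier := by
  rcases K with ⟨K, h | rfl | rfl⟩
  · exact h.1
  · exact isClosed_empty
  · exact isClosed_univ

theorem convex (K : PC n) : Convex ℝ K.carrier := by
  rcases K with ⟨K, h | rfl | rfl⟩
  · exact h.2.convex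
  · exact convex_empty
  · exact convex_univ

theorem smul_mem (K : PC n) {x : EuclideanSpace ℝ (Fin n)} (hx : x ∈ K.carrier) {c : ℝ}
    (hc : 1 ≤ c) : c • x ∈ K.carrier := by
  rcases K with ⟨K, h | rfl | rfl⟩
  · exact h.2.smul_mem x hx c hc
  · exact hx
  · trivial

theorem eq_univ_of_zero_mem (K : PC n)
    (h0 : (0 : EuclideanSpace ℝ (Fin n)) ∈ K.carrier) : K.carrier = Set.univ := by
  rcases K with ⟨K, h | rfl | rfl⟩
  · exact absurd h0 h.2.zero_notMem
  · exact absurd h0 (Set.notMem_empty _)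
  · rfl

/-- A closed convex set without the origin that is closed under scalars `c ≥ 1` (and may be
empty) belongs to the family. -/
theorem prop_of_zero_notMem {K : Set (EuclideanSpace ℝ (Fin n))} (hcl : IsClosed K)
    (hcv : Convex ℝ K) (h0 : (0 : EuclideanSpace ℝ (Fin n)) ∉ K)
    (hs : ∀ x ∈ K, ∀ c : ℝ, 1 ≤ c → c • x ∈ K) :
    (IsClosed K ∧ IsPseudoCone K) ∨ K = ∅ ∨ K = Set.univ := by
  rcases K.eq_empty_or_nonempty with h | h
  · exact Or.inr (Or.inl h)
  · exact Or.inl ⟨hcl, h, hcv, h0, hs⟩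

theorem inf_prop (K L : PC n) :
    (IsClosed (K.carrier ∩ L.carrier) ∧ IsPseudoCone (K.carrier ∩ L.carrier)) ∨
      K.carrier ∩ L.carrier = ∅ ∨ K.carrier ∩ L.carrier = Set.univ := by
  by_cases h0 : (0 : EuclideanSpace ℝ (Fin n)) ∈ K.carrier ∩ L.carrier
  · exact Or.inr (Or.inr (by
      rw [K.eq_univ_of_zero_mem h0.1, L.eq_univ_of_zero_mem h0.2, Set.inter_self]))
  · exact prop_of_zero_notMem (K.isClosed.inter L.isClosed) (K.convex.inter L.convex) h0
      fun x hx c hc => ⟨K.smul_mem hx.1 hc, L.smul_mem hx.2 hc⟩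

/-- The closed convex hull `cl[K, L]` of `K ∪ L`. -/
def hull (K L : PC n) : Set (EuclideanSpace ℝ (Fin n)) :=
  closure (convexHull ℝ (K.carrier ∪ L.carrier))

theorem hull_smul_mem (K L : PC n) (x : EuclideanSpace ℝ (Fin n)) (hx : x ∈ hull K L) (c : ℝ)
    (hc : 1 ≤ c) : c • x ∈ hull K L := by
  refine map_mem_closure (f := fun y => c • y) (continuous_const_smul c) hx fun y hy => ?_
  have hsub : convexHull ℝ (K.carrier ∪ L.carrier) ⊆
      (c • LinearMap.id : EuclideanSpace ℝ (Fin n) →ₗ[ℝ] EuclideanSpace ℝ (Fin n)) ⁻¹'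
        convexHull ℝ (K.carrier ∪ L.carrier) :=
    convexHull_min
      (fun z hz => subset_convexHull ℝ _ (hz.imp (K.smul_mem · hc) (L.smul_mem · hc)))
      ((convex_convexHull ℝ _).linear_preimage _)
  exact hsub hy

open Classical in
/-- The underlying set of the join `K ∨ L`: the closed convex hull of `K ∪ L` if it does not
contain the origin, and the whole space if it does. -/
noncomputable def joinSet (K L : PC n) : Set (EuclideanSpace ℝ (Fin n)) :=
  if (0 : EuclideanSpace ℝ (Fin n)) ∈ hull K L then Set.univ else hull K L

theorem joinSet_prop (K L : PC n) :
    (IsClosed (joinSet K L) ∧ IsPseudoCone (joinSet K L)) ∨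
      joinSet K L = ∅ ∨ joinSet K L = Set.univ := by
  unfold joinSet
  split_ifs with h0
  · exact Or.inr (Or.inr rfl)
  · exact prop_of_zero_notMem isClosed_closure (convex_convexHull ℝ _).closure h0
      (hull_smul_mem K L)

theorem hull_subset_joinSet (K L : PC n) : hull K L ⊆ joinSet K L := by
  unfold joinSet
  split_ifs with h0
  · exact Set.subset_univ _
  · exact subset_rfl

theorem union_subset_joinSet (K L : PC n) : K.carrier ∪ L.carrier ⊆ joinSet K L :=
  ((subset_convexHull ℝ _).trans subset_closure).trans (hull_subset_joinSet K L)

theorem joinSet_subset {K L M : PC n} (hK : K.carrier ⊆ M.carrier) (hL : L.carrier ⊆ M.carrier) :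
    joinSet K L ⊆ M.carrier := by
  have h : hull K L ⊆ M.carrier :=
    closure_minimal (convexHull_min (Set.union_subset hK hL) M.convex) M.isClosed
  unfold joinSet
  split_ifs with h0
  · rw [M.eq_univ_of_zero_mem (h h0)]
  · exact h

/-- The lattice structure, ordered by inclusion. The meet is the intersection; the join is
`joinSet`. -/
noncomputable instance instLattice : Lattice (PC n) where
  le K L := K.carrier ⊆ L.carrier
  le_refl _ := subset_rfl
  le_trans _ _ _ h₁ h₂ := Set.Subset.trans h₁ h₂
  le_antisymm _ _ h₁ h₂ := carrier_injective (Set.Subset.antisymm h₁ h₂)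
  inf K L := ⟨K.carrier ∩ L.carrier, inf_prop K L⟩
  sup K L := ⟨joinSet K L, joinSet_prop K L⟩
  inf_le_left _ _ := Set.inter_subset_left
  inf_le_right _ _ := Set.inter_subset_right
  le_inf _ _ _ h₁ h₂ := Set.subset_inter h₁ h₂
  le_sup_left K L := Set.subset_union_left.trans (union_subset_joinSet K L)
  le_sup_right K L := Set.subset_union_right.trans (union_subset_joinSet K L)
  sup_le _ _ _ h₁ h₂ := joinSet_subset h₁ h₂

end PC

/-! If `φ ⊥ = φ ⊤`, monotonicity makes `φ` constant. Otherwise `φ` is an order embedding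
(`map_le_map_iff_of_ne`). A failure would give `φ (ray x) ≤ φ (ray (t • x))` with `t > 1`; taking
joins with a second ray transfers this to every independent direction, where it can be iterated to
arbitrarily large factors. This contradicts the fact that a second countable space cannot separate
continuum many pointed open sets (`exists_lt_mem_of_isOpen`).

The same countability fact controls dimension. If continuum many members, all different from `D`,
have pairwise meet `D`, then one of them spans more than `D` does, and the span of `D` has
codimension at least two. Adjoining rays in varying directions to `K` gives such families, so
downward induction yields `dim_map_le`: `φ` does not raise dimensions up to `n - 2`. Hence `φ ⊥ =
⊥`, and for `n ≥ 3` rays go to rays. In the plane the bound says nothing about rays; there a lattice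
property that rays have and members with interior lack is used instead (`exists_inf_eq_ray`,
`le_of_interior_nonempty`).

Thus `φ (ray x) = ray (f x)` for a point map `f`, and `f x ∈ φ K` exactly when `x ∈ K`, for `x ≠ 0`.
On an independent pair, `f (x + y)` is a combination of `f x` and `f y`, and images of half-spaces
force both coefficients to be 1 (`coeff_eq_one`). So `f` is additive, hence rationally homogeneous;
since it preserves the direction of rays it is also monotone on lines, hence linear. Membership then
identifies `φ K` with the image of `K`. -/

/-- The Euclidean space carrying the pseudo-cones of `PC n`. -/
abbrev Euc (n : ℕ) : Type := EuclideanSpace ℝ (Fin n)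

/-! ### Functionals with prescribed values. -/

section LinearAlgebra

variable {E : Type*} [NormedAddCommGroup E] [NormedSpace ℝ E]

theorem exists_clm_le_ker_eq_one [FiniteDimensional ℝ E] {V : Submodule ℝ E} {y : E} (hy : y ∉ V) :
    ∃ f : E →L[ℝ] ℝ, (∀ v ∈ V, f v = 0) ∧ f y = 1 := by
  obtain ⟨f, hf, hV⟩ := Submodule.exists_le_ker_of_notMem hy
  refine ⟨(f y)⁻¹ • LinearMap.toContinuousLinearMap f, fun v hv => ?_, ?_⟩
  · have : f v = 0 := hV hv
    simp [this]
  · simp [hf]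

theorem linearIndependent_pair_ne_zero {x y : E} (h : LinearIndependent ℝ ![x, y]) :
    x ≠ 0 ∧ y ≠ 0 := ⟨h.ne_zero 0, h.ne_zero 1⟩

theorem notMem_span_singleton_of_pair {x y : E} (h : LinearIndependent ℝ ![x, y]) :
    y ∉ Submodule.span ℝ {x} := by
  rw [Submodule.mem_span_singleton]
  rintro ⟨a, ha⟩
  have := LinearIndependent.pair_iff.1 h a (-1) (by rw [ha]; simp)
  simp at this

theorem exists_clm_pair [FiniteDimensional ℝ E] {x y : E} (h : LinearIndependent ℝ ![x, y]) (a b : ℝ) :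
    ∃ f : E →L[ℝ] ℝ, f x = a ∧ f y = b := by
  obtain ⟨f, hf, hfy⟩ := exists_clm_le_ker_eq_one (notMem_span_singleton_of_pair h)
  obtain ⟨g, hg, hgx⟩ :=
    exists_clm_le_ker_eq_one (notMem_span_singleton_of_pair (LinearIndependent.pair_symm_iff.1 h))
  refine ⟨a • g + b • f, ?_, ?_⟩
  · simp [hgx, hf x (Submodule.mem_span_singleton_self x)]
  · simp [hfy, hg y (Submodule.mem_span_singleton_self y)]

end LinearAlgebra

/-! ### Rays, half-spaces and separation. -/

namespace PC

variable {n : ℕ}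

theorem le_def {K L : PC n} : K ≤ L ↔ K.carrier ⊆ L.carrier := Iff.rfl

instance : OrderBot (PC n) where
  bot := ⟨∅, Or.inr (Or.inl rfl)⟩
  bot_le _ := Set.empty_subset _

instance : OrderTop (PC n) where
  top := ⟨Set.univ, Or.inr (Or.inr rfl)⟩
  le_top _ := Set.subset_univ _

theorem notMem_bot (x : Euc n) : x ∉ (⊥ : PC n).carrier := Set.notMem_empty x

theorem mem_top (x : Euc n) : x ∈ (⊤ : PC n).carrier := Set.mem_univ x

theorem eq_top_iff_zero_mem {K : PC n} : K = ⊤ ↔ (0 : Euc n) ∈ K.carrier :=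
  ⟨fun h => h ▸ mem_top 0, fun h => carrier_injective (K.eq_univ_of_zero_mem h)⟩

theorem eq_bot_iff_forall {K : PC n} : K = ⊥ ↔ ∀ x, x ∉ K.carrier :=
  ⟨fun h => h ▸ notMem_bot, fun h => carrier_injective (Set.eq_empty_iff_forall_notMem.2 h)⟩

theorem combo_mem (K : PC n) {x y : Euc n} (hx : x ∈ K.carrier) (hy : y ∈ K.carrier) {a b : ℝ}
    (ha : 0 ≤ a) (hb : 0 ≤ b) (hab : 1 ≤ a + b) : a • x + b • y ∈ K.carrier := by
  have h0 : 0 < a + b := by linarith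
  have := K.smul_mem (K.convex hx hy (div_nonneg ha h0.le) (div_nonneg hb h0.le)
    (by field_simp)) hab
  rwa [smul_add, smul_smul, smul_smul, mul_div_cancel₀ _ h0.ne', mul_div_cancel₀ _ h0.ne'] at this

theorem add_mem (K : PC n) {x y : Euc n} (hx : x ∈ K.carrier) (hy : y ∈ K.carrier) :
    x + y ∈ K.carrier := by
  simpa using K.combo_mem hx hy zero_le_one zero_le_one (by norm_num)

/-- The member of the family with a given underlying closed convex set without the origin. -/
def ofSet (K : Set (Euc n)) (hcl : IsClosed K) (hcv : Convex ℝ K) (h0 : (0 : Euc n) ∉ K)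
    (hs : ∀ x ∈ K, ∀ c : ℝ, 1 ≤ c → c • x ∈ K) : PC n :=
  ⟨K, prop_of_zero_notMem hcl hcv h0 hs⟩

open Classical in
/-- The least member of the family containing `x`: the ray `{c x : c ≥ 1}` if `x ≠ 0`, and the
whole space if `x = 0`. -/
noncomputable def ray (x : Euc n) : PC n :=
  if hx : x = 0 then ⊤ else
    ofSet ((fun c : ℝ => c • x) '' Set.Ici 1)
      ((isClosedEmbedding_smul_left hx).isClosedMap _ isClosed_Ici)
      ((convex_Ici (1 : ℝ)).is_linear_image (IsLinearMap.mk' (fun c : ℝ => c • x)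
        ⟨fun a b => add_smul a b x, fun a b => by simp [smul_smul]⟩ |>.isLinear))
      (by
        rintro ⟨c, hc, h⟩
        rcases smul_eq_zero.1 h with h | h
        · rw [h] at hc
          exact absurd (Set.mem_Ici.1 hc) (by norm_num)
        · exact hx h)
      (by
        rintro _ ⟨c, hc, rfl⟩ d hd
        refine ⟨d * c, ?_, by simp [smul_smul]⟩
        simp only [Set.mem_Ici] at hc ⊢
        nlinarith)

theorem mem_ray {x y : Euc n} (hx : x ≠ 0) : y ∈ (ray x).carrier ↔ ∃ c : ℝ, 1 ≤ c ∧ c • x = y := by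
  rw [ray, dif_neg hx]
  rfl

theorem self_mem_ray (x : Euc n) : x ∈ (ray x).carrier := by
  by_cases hx : x = 0
  · rw [ray, dif_pos hx]
    exact mem_top x
  · exact (mem_ray hx).2 ⟨1, le_rfl, one_smul _ _⟩

theorem ray_le_iff {x : Euc n} {K : PC n} : ray x ≤ K ↔ x ∈ K.carrier := by
  refine ⟨fun h => h (self_mem_ray x), fun h => ?_⟩
  by_cases hx : x = 0
  · rw [(eq_top_iff_zero_mem (K := K)).2 (hx ▸ h)]
    exact le_top
  · intro y hy
    obtain ⟨c, hc, rfl⟩ := (mem_ray hx).1 hy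
    exact K.smul_mem h hc

theorem smul_mem_ray_iff {x : Euc n} (hx : x ≠ 0) {c : ℝ} : c • x ∈ (ray x).carrier ↔ 1 ≤ c := by
  rw [mem_ray hx]
  refine ⟨?_, fun h => ⟨c, h, rfl⟩⟩
  rintro ⟨d, hd, h⟩
  rwa [← smul_left_injective ℝ hx h]

theorem ray_ne_top {x : Euc n} (hx : x ≠ 0) : ray x ≠ ⊤ := by
  rw [Ne, eq_top_iff_zero_mem, ← zero_smul ℝ x, smul_mem_ray_iff hx]
  norm_num

theorem ray_inf_ray_eq_bot {x y : Euc n} (h : LinearIndependent ℝ ![x, y]) :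
    ray x ⊓ ray y = ⊥ := by
  obtain ⟨hx, hy⟩ := linearIndependent_pair_ne_zero h
  rw [eq_bot_iff_forall]
  rintro z ⟨h1, h2⟩
  obtain ⟨c, hc, rfl⟩ := (mem_ray hx).1 h1
  obtain ⟨d, hd, h'⟩ := (mem_ray hy).1 h2
  have := LinearIndependent.pair_iff.1 h c (-d) (by rw [← h']; simp)
  linarith [this.1]

/-- The half-space `{x : u x ≥ 1}`. -/
def halfspace (u : Euc n →L[ℝ] ℝ) : PC n :=
  ofSet {x | 1 ≤ u x} (isClosed_le continuous_const u.continuous)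
    (convex_halfSpace_ge u.isLinear 1) (by simp) (by
      intro x hx c hc
      simp only [Set.mem_ofPred_eq, map_smul, smul_eq_mul] at hx ⊢
      nlinarith)

theorem mem_halfspace {u : Euc n →L[ℝ] ℝ} {x : Euc n} : x ∈ (halfspace u).carrier ↔ 1 ≤ u x :=
  Iff.rfl

theorem halfspace_ne_top (u : Euc n →L[ℝ] ℝ) : halfspace u ≠ ⊤ := by
  rw [Ne, eq_top_iff_zero_mem, mem_halfspace]
  simp

theorem exists_lt_of_notMem {K : PC n} {p : Euc n} (hp : p ∉ K.carrier) :
    ∃ (g : Euc n →L[ℝ] ℝ) (α : ℝ), g p < α ∧ (∀ m ∈ K.carrier, α ≤ g m) ∧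
      ∀ m ∈ K.carrier, 0 ≤ g m := by
  obtain ⟨g, α, h1, h2⟩ := geometric_hahn_banach_point_closed K.convex K.isClosed hp
  refine ⟨g, α, h1, fun m hm => (h2 m hm).le, fun m hm => ?_⟩
  by_contra! hneg
  -- If `g m < 0`, this multiple of `m` has value `g m - |α| < α`, against the separation.
  have h3 := h2 _ (K.smul_mem hm (c := 1 + |α| / (-g m))
    (by have := div_nonneg (abs_nonneg α) (neg_nonneg.2 hneg.le); linarith))
  rw [map_smul, smul_eq_mul, add_mul, div_mul_eq_mul_div, mul_div_assoc] at h3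
  have : g m / -g m = -1 := by
    rw [div_neg, div_self hneg.ne]
  rw [this] at h3
  linarith [neg_abs_le α]

/-- Separation alone may give a nonpositive level. The functional is still nonnegative on `K` and
negative at `p`, so adding a small multiple of one that separates `K` from the origin makes the
level positive without losing `p`. -/
theorem exists_halfspace_of_notMem {K : PC n} {p : Euc n} (hp : p ∉ K.carrier) :
    ∃ u : Euc n →L[ℝ] ℝ, K ≤ halfspace u ∧ u p < 1 := by
  have h0 : (0 : Euc n) ∉ K.carrier := fun h => hp (eq_top_iff_zero_mem.2 h ▸ mem_top p)
  have key : ∀ (g : Euc n →L[ℝ] ℝ) (α : ℝ), 0 < α → g p < α → (∀ m ∈ K.carrier, α ≤ g m) →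
      ∃ u : Euc n →L[ℝ] ℝ, K ≤ halfspace u ∧ u p < 1 := by
    intro g α hα h1 h2
    refine ⟨α⁻¹ • g, fun m hm => ?_, ?_⟩
    · have := h2 m hm
      simp only [mem_halfspace, smul_apply, smul_eq_mul]
      rw [← div_eq_inv_mul, le_div_iff₀ hα]
      linarith
    · simp only [smul_apply, smul_eq_mul]
      rw [← div_eq_inv_mul, div_lt_iff₀ hα]
      linarith
  obtain ⟨g, α, h1, h2, h3⟩ := exists_lt_of_notMem hp
  obtain ⟨h, β, k1, k2, -⟩ := exists_lt_of_notMem h0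
  rw [map_zero] at k1
  rcases lt_or_ge 0 α with hα | hα
  · exact key g α hα h1 h2
  · have hgp : g p < 0 := h1.trans_le hα
    have hden : 0 < |h p| + 1 := by positivity
    set ε := -g p / (|h p| + 1) with hε
    have hε0 : 0 < ε := div_pos (by linarith) hden
    have hεe : ε * (|h p| + 1) = -g p := by rw [hε]; field_simp
    refine key (g + ε • h) (ε * β) (by positivity) ?_ fun m hm => ?_
    · simp only [add_apply, smul_apply, smul_eq_mul]
      nlinarith [le_abs_self (h p), mul_pos hε0 k1]
    · simp only [add_apply, smul_apply, smul_eq_mul]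
      nlinarith [h3 m hm, k2 m hm]

theorem ray_sup_ray_neg (x : Euc n) : ray x ⊔ ray (-x) = ⊤ := by
  rw [eq_top_iff_zero_mem]
  have := (ray x ⊔ ray (-x)).add_mem (ray_le_iff.1 le_sup_left) (ray_le_iff.1 le_sup_right)
  simpa using this

/-- The points `s • x` lie on segments from `y` to points `x - c • y` of the bounding hyperplane,
with `c` unbounded as `s → 0`. The closure therefore contains the origin. -/
theorem halfspace_sup_ray {u : Euc n →L[ℝ] ℝ} {x y : Euc n} (hx : u x = 1) (hy : u y = 0) :
    halfspace u ⊔ ray y = ⊤ := by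
  rw [eq_top_iff_zero_mem]
  set N := halfspace u ⊔ ray y
  have h1 : y ∈ N.carrier := ray_le_iff.1 le_sup_right
  have h2 : ∀ c : ℝ, x - c • y ∈ N.carrier := fun c =>
    (le_sup_left : halfspace u ≤ N) (mem_halfspace.2 (by simp [hx, hy]))
  have h3 : ∀ s : ℝ, s ∈ Set.Ioc (0 : ℝ) 1 → s • x ∈ N.carrier := by
    intro s hs
    have := N.convex (h2 ((1 - s) / s)) h1 hs.1.le (by linarith [hs.2] : 0 ≤ 1 - s) (by ring)
    rwa [smul_sub, smul_smul, mul_div_cancel₀ _ hs.1.ne', sub_add_cancel] at this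
  have hc : Filter.Tendsto (fun s : ℝ => s • x) (nhdsWithin 0 (Set.Ioi 0)) (nhds 0) := by
    have : Continuous fun s : ℝ => s • x := by fun_prop
    have := this.tendsto 0
    rw [zero_smul] at this
    exact this.mono_left nhdsWithin_le_nhds
  refine N.isClosed.mem_of_tendsto hc ?_
  filter_upwards [Ioc_mem_nhdsGT (zero_lt_one (α := ℝ))] with s hs using h3 s hs

theorem eq_top_of_forall_ne_zero_mem [Nontrivial (Euc n)] {K : PC n}
    (h : ∀ x : Euc n, x ≠ 0 → x ∈ K.carrier) : K = ⊤ := by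
  obtain ⟨x, hx⟩ := exists_ne (0 : Euc n)
  rw [eq_top_iff_zero_mem]
  simpa using K.add_mem (h x hx) (h (-x) (neg_ne_zero.2 hx))

theorem ray_sup_ray_ne_top {x y : Euc n} (h : LinearIndependent ℝ ![x, y]) :
    ray x ⊔ ray y ≠ ⊤ := by
  obtain ⟨u, hx, hy⟩ := exists_clm_pair h 1 1
  intro hT
  have : ray x ⊔ ray y ≤ halfspace u :=
    sup_le (ray_le_iff.2 (mem_halfspace.2 hx.ge)) (ray_le_iff.2 (mem_halfspace.2 hy.ge))
  exact halfspace_ne_top u (top_le_iff.1 (hT ▸ this))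

theorem linearIndependent_of_rays {p q : Euc n} (hp : p ≠ 0) (hq : q ≠ 0)
    (hinf : ray p ⊓ ray q = ⊥) (hsup : ray p ⊔ ray q ≠ ⊤) : LinearIndependent ℝ ![p, q] := by
  rw [LinearIndependent.pair_iff' hp]
  rintro a rfl
  have ha : a ≠ 0 := by
    rintro rfl
    simp at hq
  rcases lt_or_gt_of_ne ha with ha | ha
  · refine hsup (eq_top_iff_zero_mem.2 ?_)
    have h1 : p ∈ (ray p ⊔ ray (a • p)).carrier := ray_le_iff.1 le_sup_left
    have h2 : a • p ∈ (ray p ⊔ ray (a • p)).carrier := ray_le_iff.1 le_sup_right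
    have := (ray p ⊔ ray (a • p)).convex h1 h2 (a := -a / (1 - a)) (b := 1 / (1 - a))
      (div_nonneg (by linarith) (by linarith)) (div_nonneg (by linarith) (by linarith))
      (by rw [← add_div]; exact (div_eq_one_iff_eq (by linarith)).2 (by ring))
    rwa [smul_smul, ← add_smul, show -a / (1 - a) + 1 / (1 - a) * a = 0 by ring, zero_smul] at this
  · refine eq_bot_iff_forall.1 hinf ((1 + a) • p) ⟨?_, ?_⟩
    · exact (smul_mem_ray_iff hp).2 (by linarith)
    · refine (mem_ray hq).2 ⟨(1 + a) / a, ?_, ?_⟩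
      · rw [le_div_iff₀ ha]
        linarith
      · rw [smul_smul, div_mul_cancel₀ _ ha.ne']

end PC

/-! ### Countability, and injectivity of nonconstant endomorphisms. -/

/-- Uncountably many pointed open sets in a second countable space cannot be mutually separated. -/
theorem exists_lt_mem_of_isOpen {X : Type*} [TopologicalSpace X] [SecondCountableTopology X]
    (p : ℝ → X) (O : ℝ → Set X) (hO : ∀ r, IsOpen (O r)) (hp : ∀ r, p r ∈ O r) :
    ∃ r q : ℝ, r < q ∧ p q ∈ O r ∧ p r ∈ O q := by
  have hB := TopologicalSpace.isBasis_countableBasis X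
  choose b hb hpb hbO using fun r => hB.exists_subset_of_mem_open (hp r) (hO r)
  have : ∃ r q : ℝ, r ≠ q ∧ b r = b q := by
    by_contra! hinj
    have hi : Function.Injective
        (fun r => (⟨b r, hb r⟩ : TopologicalSpace.countableBasis X)) := by
      intro r q h
      by_contra hne
      exact hinj r q hne (congrArg Subtype.val h)
    have : Countable (TopologicalSpace.countableBasis X) :=
      (TopologicalSpace.countable_countableBasis X).to_subtype
    exact not_countable (α := ℝ) hi.countable
  obtain ⟨r, q, hne, h⟩ := this
  rcases lt_or_gt_of_ne hne with hlt | hlt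
  · exact ⟨r, q, hlt, hbO r (h ▸ hpb q), hbO q (h ▸ hpb r)⟩
  · exact ⟨q, r, hlt, hbO q (h ▸ hpb r), hbO r (h ▸ hpb q)⟩

namespace PC

variable {n : ℕ}

theorem exists_linearIndependent_pair (hn : 2 ≤ n) {x : Euc n} (hx : x ≠ 0) :
    ∃ z : Euc n, LinearIndependent ℝ ![x, z] :=
  exists_linearIndependent_pair_of_one_lt_finrank (by rw [finrank_euclideanSpace_fin]; omega) hx

theorem nontrivial_euc (hn : 2 ≤ n) : Nontrivial (Euc n) :=
  Module.nontrivial_of_finrank_pos (R := ℝ) (by rw [finrank_euclideanSpace_fin]; omega)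

/-- Since `z = x + (z - x)`, the ray of `z` lies below `ray x ⊔ ray (z - x)`. Once `ray x` is
collapsed, this join has the same image as `ray (z - x)`, which meets `ray z` in `⊥`. -/
theorem map_ray_eq_of_pair (φ : LatticeHom (PC n) (PC n)) {x z : Euc n}
    (h : LinearIndependent ℝ ![x, z]) (hx : φ (ray x) = φ ⊥) : φ (ray z) = φ ⊥ := by
  have hi : LinearIndependent ℝ ![z, z - x] := by
    rw [LinearIndependent.pair_iff] at h ⊢
    intro s t hst
    have := h (-t) (s + t) (by rw [← hst]; module)
    exact ⟨by linarith, by linarith⟩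
  have hle : ray z ≤ ray x ⊔ ray (z - x) := by
    rw [ray_le_iff]
    have := (ray x ⊔ ray (z - x)).add_mem (ray_le_iff.1 le_sup_left) (ray_le_iff.1 le_sup_right)
    rwa [add_sub_cancel] at this
  have h2 : φ (ray x ⊔ ray (z - x)) = φ (ray (z - x)) := by
    rw [map_sup, hx, ← map_sup, bot_sup_eq]
  calc φ (ray z) = φ (ray z ⊓ (ray x ⊔ ray (z - x))) := by rw [inf_eq_left.2 hle]
    _ = φ (ray z ⊓ ray (z - x)) := by rw [map_inf, h2, map_inf]
    _ = φ ⊥ := by rw [ray_inf_ray_eq_bot hi]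

theorem map_ray_ne_map_bot (hn : 2 ≤ n) (φ : LatticeHom (PC n) (PC n)) (hφ : φ ⊥ ≠ φ ⊤)
    {x : Euc n} (hx : x ≠ 0) : φ (ray x) ≠ φ ⊥ := by
  intro h
  obtain ⟨z, hz⟩ := exists_linearIndependent_pair hn hx
  have h1 := map_ray_eq_of_pair φ hz h
  have hz' : LinearIndependent ℝ ![z, -x] := by
    rw [LinearIndependent.pair_iff] at hz ⊢
    intro s t hst
    have := hz (-t) s (by rw [← hst]; module)
    exact ⟨this.2, by linarith [this.1]⟩
  have h2 := map_ray_eq_of_pair φ hz' h1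
  apply hφ
  rw [← ray_sup_ray_neg x, map_sup, h, h2, sup_idem]

theorem map_ray_le_of_pair (φ : LatticeHom (PC n) (PC n)) {x z : Euc n} {t : ℝ} (ht : 1 < t)
    (h : LinearIndependent ℝ ![x, z]) (hx : φ (ray x) ≤ φ (ray (t • x))) :
    φ (ray z) ≤ φ (ray ((2 * t / (1 + t)) • z)) := by
  have hz0 := (linearIndependent_pair_ne_zero h).2
  have ht0 : t ≠ 0 := by linarith
  have ht1 : (1 : ℝ) + t ≠ 0 := by linarith
  -- `z` is the midpoint of `x` and `y`. Moving `x` out to `t • x` moves the point where the joining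
  -- segment crosses the line of `z` out by the factor `2 * t / (1 + t)`.
  set y := (2 : ℝ) • z - x with hy
  have hle : ray z ≤ ray x ⊔ ray y := by
    rw [ray_le_iff]
    have := (ray x ⊔ ray y).convex (ray_le_iff.1 le_sup_left) (ray_le_iff.1 le_sup_right)
      (a := 1 / 2) (b := 1 / 2) (by norm_num) (by norm_num) (by norm_num)
    convert this using 1
    rw [hy]
    module
  -- These values make `g` equal to 1 at both `t • x` and `y`.
  obtain ⟨g, hgx, hgz⟩ := exists_clm_pair h t⁻¹ ((1 + t) / (2 * t))
  have hsup : ray (t • x) ⊔ ray y ≤ halfspace g := by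
    refine sup_le (ray_le_iff.2 (mem_halfspace.2 ?_)) (ray_le_iff.2 (mem_halfspace.2 ?_))
    · rw [map_smul, hgx, smul_eq_mul, mul_inv_cancel₀ ht0]
    · rw [hy, map_sub, map_smul, hgx, hgz, smul_eq_mul]
      apply le_of_eq
      field_simp
      ring
  have hinf : ray z ⊓ (ray (t • x) ⊔ ray y) ≤ ray ((2 * t / (1 + t)) • z) := by
    rintro w ⟨h1, h2⟩
    obtain ⟨c, hc, rfl⟩ := (mem_ray hz0).1 h1
    have h3 : 1 ≤ g (c • z) := hsup h2
    rw [map_smul, hgz, smul_eq_mul] at h3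
    refine (mem_ray (smul_ne_zero (by positivity) hz0)).2 ⟨c * ((1 + t) / (2 * t)), h3, ?_⟩
    rw [smul_smul]
    congr 1
    field_simp
  calc φ (ray z) ≤ φ (ray z) ⊓ φ (ray x ⊔ ray y) := le_inf le_rfl (OrderHomClass.mono φ hle)
    _ ≤ φ (ray z) ⊓ φ (ray (t • x) ⊔ ray y) := by
        rw [map_sup, map_sup]
        exact inf_le_inf_left _ (sup_le_sup_right hx _)
    _ = φ (ray z ⊓ (ray (t • x) ⊔ ray y)) := (map_inf φ _ _).symm
    _ ≤ _ := OrderHomClass.mono φ hinf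

theorem ray_smul_le_ray_smul {x : Euc n} {c d : ℝ} (hc : 0 < c) (h : c ≤ d) :
    ray (d • x) ≤ ray (c • x) := by
  rw [ray_le_iff]
  have := (ray (c • x)).smul_mem (self_mem_ray _) (c := d / c) (by rwa [le_div_iff₀ hc, one_mul])
  rwa [smul_smul, div_mul_cancel₀ _ hc.ne'] at this

/-- The factor gained in `map_ray_le_of_pair` depends on `t` only, so that lemma can be reapplied to
each multiple of `z` and the factors multiply beyond any bound. -/
theorem map_ray_le_map_ray_smul (φ : LatticeHom (PC n) (PC n)) {x z : Euc n} {t : ℝ} (ht : 1 < t)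
    (h : LinearIndependent ℝ ![x, z]) (hx : φ (ray x) ≤ φ (ray (t • x))) {c : ℝ}
    (hc : 0 < c) : φ (ray z) ≤ φ (ray (c • z)) := by
  set s := 2 * t / (1 + t) with hs
  have hs1 : 1 < s := by
    rw [hs, lt_div_iff₀ (by linarith)]
    linarith
  have hk : ∀ k : ℕ, φ (ray z) ≤ φ (ray (s ^ k • z)) := by
    intro k
    induction k with
    | zero => simp
    | succ k ih =>
      have hi : LinearIndependent ℝ ![x, s ^ k • z] := by
        rw [LinearIndependent.pair_iff] at h ⊢
        intro a b hab
        have := h a (b * s ^ k) (by rw [← hab, smul_smul])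
        exact ⟨this.1, (mul_eq_zero.1 this.2).resolve_right (by positivity)⟩
      have := map_ray_le_of_pair φ ht hi hx
      rw [← hs, smul_smul, ← pow_succ'] at this
      exact ih.trans this
  obtain ⟨k, hk'⟩ := pow_unbounded_of_one_lt c hs1
  exact (hk k).trans (OrderHomClass.mono φ (ray_smul_le_ray_smul hc hk'.le))

theorem not_map_ray_le_map_ray_smul (hn : 2 ≤ n) (φ : LatticeHom (PC n) (PC n)) (hφ : φ ⊥ ≠ φ ⊤)
    {x : Euc n} (hx : x ≠ 0) {t : ℝ} (ht : 1 < t) : ¬ φ (ray x) ≤ φ (ray (t • x)) := by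
  intro hle
  obtain ⟨e, he⟩ := exists_linearIndependent_pair hn hx
  have hind : ∀ r : ℝ, LinearIndependent ℝ ![x, e + r • x] := by
    intro r
    rw [LinearIndependent.pair_iff] at he ⊢
    intro a b hab
    have := he (a + b * r) b (by rw [← hab]; module)
    exact ⟨by simpa [this.2] using this.1, this.2⟩
  have hne : ∀ r : ℝ, e + r • x ≠ 0 := fun r => (linearIndependent_pair_ne_zero (hind r)).2
  have hp : ∀ r : ℝ, ∃ p, p ∈ (φ (ray (e + r • x))).carrier ∧ p ∉ (φ ⊥).carrier := by
    intro r
    by_contra! hcon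
    exact map_ray_ne_map_bot hn φ hφ (hne r) (le_antisymm hcon (OrderHomClass.mono φ bot_le))
  choose p hp1 hp2 using hp
  -- `u r` vanishes at `e + r • x`, so its half-space misses that ray, but is positive at `e + q •
  -- x` for `q > r`, so it contains a far part of that one. By the collapse, containing a far part
  -- is as good, after `φ`, as containing the whole ray.
  choose u hux hue using fun r : ℝ => exists_clm_pair he 1 (-r)
  have hu : ∀ r q : ℝ, u r (e + q • x) = q - r := by
    intro r q
    rw [map_add, map_smul, hux, hue, smul_eq_mul]
    ring
  have hout : ∀ r, p r ∈ (φ (halfspace (u r))).carrierᶜ := by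
    intro r hr
    have hb : ray (e + r • x) ⊓ halfspace (u r) = ⊥ := by
      rw [eq_bot_iff_forall]
      rintro y ⟨h1, h2⟩
      obtain ⟨c, -, rfl⟩ := (mem_ray (hne r)).1 h1
      have h3 : 1 ≤ u r (c • (e + r • x)) := h2
      rw [map_smul, hu, sub_self, smul_zero] at h3
      linarith
    apply hp2 r
    rw [← hb, map_inf]
    exact ⟨hp1 r, hr⟩
  obtain ⟨r, q, hrq, h1, -⟩ := exists_lt_mem_of_isOpen p
    (fun r => (φ (halfspace (u r))).carrierᶜ) (fun r => (PC.isClosed _).isOpen_compl) hout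
  apply h1
  have hpos : 0 < (q - r)⁻¹ := inv_pos.2 (by linarith)
  have h2 := map_ray_le_map_ray_smul φ ht (hind q) hle hpos
  refine OrderHomClass.mono φ (ray_le_iff.2 (mem_halfspace.2 ?_)) (h2 (hp1 q))
  rw [map_smul, hu, smul_eq_mul, inv_mul_cancel₀ (by linarith)]

theorem map_le_map_iff_of_ne (hn : 2 ≤ n) (φ : LatticeHom (PC n) (PC n)) (hφ : φ ⊥ ≠ φ ⊤)
    {K L : PC n} : φ K ≤ φ L ↔ K ≤ L := by
  refine ⟨fun hKL => ?_, fun h => OrderHomClass.mono φ h⟩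
  by_contra hnot
  have : ∃ x : Euc n, x ≠ 0 ∧ x ∈ K.carrier ∧ x ∉ L.carrier := by
    by_contra! hcon
    apply hnot
    intro x hx
    by_cases hx0 : x = 0
    · have := nontrivial_euc hn
      have hK : K = ⊤ := eq_top_iff_zero_mem.2 (hx0 ▸ hx)
      rw [eq_top_of_forall_ne_zero_mem (K := L) fun y hy => hcon y hy (hK ▸ mem_top y)]
      exact mem_top x
    · exact hcon x hx0 hx
  obtain ⟨x, hx0, hxK, hxL⟩ := this
  -- As `L` is closed, the ray of `x` enters it, if at all, strictly beyond `x`.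
  have : ∃ t : ℝ, 1 < t ∧ t • x ∉ L.carrier := by
    have hopen : IsOpen {t : ℝ | t • x ∈ L.carrierᶜ} :=
      L.isClosed.isOpen_compl.preimage (by fun_prop)
    have hm := hopen.mem_nhds (x := 1) (by simpa using hxL)
    have hev : ∀ᶠ t in nhdsWithin (1 : ℝ) (Set.Ioi 1), t • x ∈ L.carrierᶜ := nhdsWithin_le_nhds hm
    obtain ⟨t, ht, ht1⟩ := (hev.and self_mem_nhdsWithin).exists
    exact ⟨t, ht1, ht⟩
  obtain ⟨t, ht, htL⟩ := this
  apply not_map_ray_le_map_ray_smul hn φ hφ hx0 ht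
  have hle : ray x ⊓ L ≤ ray (t • x) := by
    rintro y ⟨h1, h2⟩
    obtain ⟨c, hc, rfl⟩ := (mem_ray hx0).1 h1
    have hct : t < c := by
      by_contra! hct
      apply htL
      have hc0 : 0 < c := by linarith
      have := L.smul_mem h2 (c := t / c) (by rwa [le_div_iff₀ hc0, one_mul])
      rwa [smul_smul, div_mul_cancel₀ _ hc0.ne'] at this
    exact ray_smul_le_ray_smul (by linarith) hct.le (self_mem_ray _)
  calc φ (ray x) ≤ φ (ray x ⊓ L) := by
        rw [map_inf]
        exact le_inf le_rfl ((OrderHomClass.mono φ (ray_le_iff.2 hxK)).trans hKL)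
    _ ≤ _ := OrderHomClass.mono φ hle

theorem injective_of_ne (hn : 2 ≤ n) (φ : LatticeHom (PC n) (PC n)) (hφ : φ ⊥ ≠ φ ⊤) :
    Function.Injective φ := fun _ _ h =>
  le_antisymm ((map_le_map_iff_of_ne hn φ hφ).1 h.le) ((map_le_map_iff_of_ne hn φ hφ).1 h.ge)

/-! ### Dimension of spans and its behaviour under endomorphisms. -/

/-- The dimension of the linear span of `K`. -/
noncomputable def dim (K : PC n) : ℕ := Module.finrank ℝ (Submodule.span ℝ K.carrier)

theorem dim_le (K : PC n) : K.dim ≤ n :=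
  (Submodule.finrank_le (Submodule.span ℝ K.carrier)).trans_eq finrank_euclideanSpace_fin

/-- A relative interior point serves: every `x ∈ D` is the difference `2 • x - x` of points of `D`,
so the affine hull has the linear span as its direction. -/
theorem exists_ball_subset (D : PC n) (hD : D.carrier.Nonempty) :
    ∃ c ∈ D.carrier, ∃ δ > 0, ∀ v ∈ Submodule.span ℝ D.carrier, ‖v‖ < δ → c + v ∈ D.carrier := by
  obtain ⟨_, c, hc, rfl⟩ := hD.intrinsicInterior D.convex
  have hcD : (c : Euc n) ∈ D.carrier := interior_subset (s := Subtype.val ⁻¹' D.carrier) hc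
  obtain ⟨δ, hδ, hball⟩ := Metric.mem_nhds_iff.1 (mem_interior_iff_mem_nhds.1 hc)
  refine ⟨c, hcD, δ, hδ, fun v hv hvδ => ?_⟩
  have hspan : Submodule.span ℝ D.carrier ≤ vectorSpan ℝ D.carrier := by
    rw [Submodule.span_le]
    intro x hx
    have := vsub_mem_vectorSpan ℝ (D.smul_mem hx (one_le_two (α := ℝ))) hx
    rwa [vsub_eq_sub, two_smul, add_sub_cancel_right] at this
  have hmem : v +ᵥ (c : Euc n) ∈ affineSpan ℝ D.carrier :=
    AffineSubspace.vadd_mem_of_mem_direction (by rw [direction_affineSpan]; exact hspan hv) c.2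
  have := @hball ⟨v +ᵥ (c : Euc n), hmem⟩ (by
    rw [Metric.mem_ball, Subtype.dist_eq, dist_eq_norm]
    simpa using hvδ)
  simpa [add_comm] using this

/-- The hypotheses say that the span of `D` has codimension at most one in `V`. Points `p r ∈ F r`
outside `D` either lie in that span or on one of its two sides. Two nearby points in the span, or
any two on the same side, would force a common point of `F r` and `F q` outside `D`. The sets `O r`
encode this. -/
theorem not_forall_inf_eq (D : PC n) (hne : D.carrier.Nonempty) (F : ℝ → PC n)
    (hinf : ∀ r q, r ≠ q → F r ⊓ F q = D) (hF : ∀ r, F r ≠ D) (V : Submodule ℝ (Euc n))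
    (hFV : ∀ r, ∀ p ∈ (F r).carrier, p ∈ V) (ℓ : Euc n →L[ℝ] ℝ)
    (hD : ∀ x ∈ D.carrier, ℓ x = 0)
    (hℓ : ∀ p ∈ V, ℓ p = 0 → p ∈ Submodule.span ℝ D.carrier) : False := by
  have hDF : ∀ r, D ≤ F r := fun r => by
    rw [← hinf r (r + 1) (by simp)]
    exact inf_le_left
  have hnot : ∀ r q, r ≠ q → ∀ y ∈ (F r).carrier, y ∈ (F q).carrier → y ∈ D.carrier := by
    intro r q hrq y h1 h2
    rw [← hinf r q hrq]
    exact ⟨h1, h2⟩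
  have hp : ∀ r, ∃ p, p ∈ (F r).carrier ∧ p ∉ D.carrier := by
    intro r
    by_contra! hcon
    exact hF r (le_antisymm hcon (hDF r))
  choose p hp1 hp2 using hp
  obtain ⟨c, hc, δ, hδ, hball⟩ := exists_ball_subset D hne
  have hO : ∀ r, ∃ O : Set (Euc n), IsOpen O ∧ p r ∈ O ∧
      ∀ q, r ≠ q → p q ∈ O → ℓ (p r) = 0 ∧ ℓ (p q) ≠ 0 := by
    intro r
    by_cases h0 : ℓ (p r) = 0
    -- Pushed slightly towards the relative interior point `c`, the point `p r` stays outside `D`.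
    -- The ball around `c` then absorbs the error `p r - p q`, so that `p r + ε • c` also lies in `F
    -- q`.
    · have : ∃ ε : ℝ, 0 < ε ∧ p r + ε • c ∉ D.carrier := by
        have hopen : IsOpen {ε : ℝ | p r + ε • c ∈ D.carrierᶜ} :=
          D.isClosed.isOpen_compl.preimage (by fun_prop)
        have hm := hopen.mem_nhds (x := 0) (by simpa using hp2 r)
        have hev : ∀ᶠ ε in nhdsWithin (0 : ℝ) (Set.Ioi 0), p r + ε • c ∈ D.carrierᶜ :=
          nhdsWithin_le_nhds hm
        obtain ⟨ε, hε, hε0⟩ := (hev.and self_mem_nhdsWithin).exists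
        exact ⟨ε, hε0, hε⟩
      obtain ⟨ε, hε, hεD⟩ := this
      refine ⟨Metric.ball (p r) (ε * δ), Metric.isOpen_ball,
        Metric.mem_ball_self (by positivity), fun q hq hqO => ⟨h0, fun hq0 => hεD ?_⟩⟩
      have hv : ε⁻¹ • (p r - p q) ∈ Submodule.span ℝ D.carrier :=
        Submodule.smul_mem _ _ (Submodule.sub_mem _ (hℓ _ (hFV r _ (hp1 r)) h0)
          (hℓ _ (hFV q _ (hp1 q)) hq0))
      have hn : ‖ε⁻¹ • (p r - p q)‖ < δ := by
        rw [norm_smul, norm_inv, Real.norm_of_nonneg hε.le, inv_mul_lt_iff₀ hε, ← dist_eq_norm,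
          dist_comm]
        exact hqO
      have h1 := (F q).combo_mem (hp1 q) (hDF q (hball _ hv hn)) zero_le_one hε.le (by linarith)
      rw [one_smul, smul_add, smul_inv_smul₀ hε.ne',
        show p q + (ε • c + (p r - p q)) = p r + ε • c by abel] at h1
      refine hnot r q hq _ ?_ h1
      simpa using (F r).combo_mem (hp1 r) (hDF r hc) zero_le_one hε.le (by linarith)
    · refine ⟨{y | 0 < ℓ y * ℓ (p r)}, isOpen_lt continuous_const (by fun_prop),
        mul_self_pos.2 h0, fun q hq hqO => ?_⟩
      exfalso
      have hq0 : ℓ (p q) ≠ 0 := fun h => by simp [h] at hqO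
      set s := ℓ (p r) / ℓ (p q) with hs
      have hs0 : 0 < s := by
        have h1 : 0 < ℓ (p q) * ℓ (p r) := hqO
        have : s = ℓ (p q) * ℓ (p r) / (ℓ (p q) * ℓ (p q)) := by
          rw [hs]
          field_simp
        rw [this]
        exact div_pos h1 (mul_self_pos.2 hq0)
      -- On one side of the span, `p r` is a positive multiple of `p q` up to a vector of the span,
      -- which again is absorbed near `c`. So `c + ε • p r` lies in both members, though `ℓ` does
      -- not vanish there.
      have hh : p r - s • p q ∈ Submodule.span ℝ D.carrier := by
        refine hℓ _ (V.sub_mem (hFV r _ (hp1 r)) (V.smul_mem _ (hFV q _ (hp1 q)))) ?_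
        rw [map_sub, map_smul, smul_eq_mul, hs, div_mul_cancel₀ _ hq0, sub_self]
      obtain ⟨ε, hε, hεδ⟩ : ∃ ε : ℝ, 0 < ε ∧ ε * ‖p r - s • p q‖ < δ := by
        refine ⟨δ / (‖p r - s • p q‖ + 1), by positivity, ?_⟩
        rw [div_mul_eq_mul_div, div_lt_iff₀ (by positivity)]
        nlinarith [norm_nonneg (p r - s • p q)]
      have h1 : c + ε • (p r - s • p q) ∈ D.carrier := by
        refine hball _ (Submodule.smul_mem _ _ hh) ?_
        rwa [norm_smul, Real.norm_of_nonneg hε.le]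
      have h2 := (F q).combo_mem (hDF q h1) (hp1 q) zero_le_one (b := ε * s) (by positivity)
        (by nlinarith [mul_pos hε hs0])
      have h3 := (F r).combo_mem (hDF r hc) (hp1 r) zero_le_one hε.le (by linarith)
      rw [show (1 : ℝ) • (c + ε • (p r - s • p q)) + (ε * s) • p q = (1 : ℝ) • c + ε • p r by
        module] at h2
      have h4 := hD _ (hnot r q hq _ h3 h2)
      rw [map_add, map_smul, map_smul, hD c hc, smul_zero, zero_add, smul_eq_mul] at h4
      exact (mul_ne_zero hε.ne' h0) h4
  choose O hO1 hO2 hO3 using hO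
  obtain ⟨r, q, hrq, h1, h2⟩ := exists_lt_mem_of_isOpen p O hO1 hO2
  exact (hO3 r q hrq.ne h1).2 (hO3 q r hrq.ne' h2).1

theorem dim_bot : (⊥ : PC n).dim = 0 := by
  have : (⊥ : PC n).carrier = ∅ := rfl
  rw [dim, this, Submodule.span_empty, finrank_bot]

theorem eq_bot_of_dim_eq_zero (hn : 2 ≤ n) {K : PC n} (hK : K.dim = 0) : K = ⊥ := by
  have hb : Submodule.span ℝ K.carrier = ⊥ := Submodule.finrank_eq_zero.1 hK
  rw [Submodule.span_eq_bot] at hb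
  rw [eq_bot_iff_forall]
  intro x hx
  have hT : K = ⊤ := eq_top_iff_zero_mem.2 (hb x hx ▸ hx)
  have := nontrivial_euc hn
  obtain ⟨y, hy⟩ := exists_ne (0 : Euc n)
  exact hy (hb y (hT ▸ mem_top y))

/-- Otherwise every `F r` lies in the span of `D`, and `not_forall_inf_eq` applies with `ℓ = 0`. -/
theorem exists_dim_lt (hn : 2 ≤ n) (D : PC n) (F : ℝ → PC n)
    (hinf : ∀ r q, r ≠ q → F r ⊓ F q = D) (hF : ∀ r, F r ≠ D) : ∃ r, D.dim < (F r).dim := by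
  by_contra! hcon
  have hDF : ∀ r, D ≤ F r := fun r => by
    rw [← hinf r (r + 1) (by simp)]
    exact inf_le_left
  rcases D.carrier.eq_empty_or_nonempty with hD | hD
  · have hb : D = ⊥ := carrier_injective hD
    refine hF 0 (hb ▸ eq_bot_of_dim_eq_zero hn ?_)
    have := hcon 0
    rw [hb, dim_bot] at this
    omega
  · refine not_forall_inf_eq D hD F hinf hF (Submodule.span ℝ D.carrier) (fun r p hp => ?_) 0
      (by simp) (fun p hp _ => hp)
    have := Submodule.eq_of_le_of_finrank_le (Submodule.span_mono (R := ℝ) (hDF r)) (hcon r)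
    rw [this]
    exact Submodule.subset_span hp

/-- If the span of `D` is the whole space or a hyperplane, it is the kernel of a functional, and
`not_forall_inf_eq` applies with `V = ⊤`. -/
theorem dim_le_sub_two (hn : 2 ≤ n) (D : PC n) (F : ℝ → PC n)
    (hinf : ∀ r q, r ≠ q → F r ⊓ F q = D) (hF : ∀ r, F r ≠ D) : D.dim ≤ n - 2 := by
  by_contra! hcon
  have hne : D.carrier.Nonempty := by
    rw [Set.nonempty_iff_ne_empty]
    intro h
    have hb : D = ⊥ := carrier_injective h
    rw [hb, dim_bot] at hcon
    omega
  obtain ⟨ℓ, h1, h2⟩ : ∃ ℓ : Euc n →L[ℝ] ℝ, (∀ x ∈ D.carrier, ℓ x = 0) ∧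
      ∀ p, ℓ p = 0 → p ∈ Submodule.span ℝ D.carrier := by
    by_cases hT : Submodule.span ℝ D.carrier = ⊤
    · exact ⟨0, by simp, fun p _ => hT ▸ Submodule.mem_top⟩
    · obtain ⟨f, hf0, hf⟩ := Submodule.exists_le_ker_of_lt_top _ (lt_top_iff_ne_top.2 hT)
      have hk := Module.Dual.finrank_ker_add_one_of_ne_zero hf0
      rw [finrank_euclideanSpace_fin] at hk
      have := Submodule.eq_of_le_of_finrank_le hf (show _ ≤ D.dim by omega)
      refine ⟨LinearMap.toContinuousLinearMap f, fun x hx => hf (Submodule.subset_span hx), ?_⟩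
      intro p hp
      rw [this]
      exact hp
  exact not_forall_inf_eq D hne F hinf hF ⊤ (fun _ _ _ => Submodule.mem_top) ℓ h1
    (fun p _ => h2 p)

/-- A half-space separating `p` from `K` can be altered off `V` so as to contain `y`, without
changing it on `V`. -/
theorem mem_of_mem_sup_ray {K : PC n} {V : Submodule ℝ (Euc n)} (hK : ∀ x ∈ K.carrier, x ∈ V)
    {y p : Euc n} (hy : y ∉ V) (hp : p ∈ (K ⊔ ray y).carrier) (hpV : p ∈ V) : p ∈ K.carrier := by
  by_contra hpK
  obtain ⟨u, hu, hup⟩ := exists_halfspace_of_notMem hpK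
  obtain ⟨f, hf, hfy⟩ := exists_clm_le_ker_eq_one hy
  have : K ⊔ ray y ≤ halfspace (u + (1 - u y) • f) := by
    refine sup_le (fun m hm => ?_) (ray_le_iff.2 ?_)
    · simpa [mem_halfspace, hf m (hK m hm)] using hu hm
    · simp [mem_halfspace, hfy]
  have := this hp
  simp only [mem_halfspace, add_apply, smul_apply, hf p hpV, smul_zero, add_zero] at this
  linarith

theorem sup_ray_ne_top {K : PC n} {V : Submodule ℝ (Euc n)} (hK : ∀ x ∈ K.carrier, x ∈ V)
    {y : Euc n} (hy : y ∉ V) : K ⊔ ray y ≠ ⊤ := by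
  intro h
  have h0 := mem_of_mem_sup_ray hK hy (eq_top_iff_zero_mem.1 h) V.zero_mem
  exact hy (hK y (eq_top_iff_zero_mem.2 h0 ▸ mem_top y))

theorem subset_of_sup_ne_top {K L : PC n} {V : Submodule ℝ (Euc n)}
    (hK : ∀ x ∈ K.carrier, x ∈ V) (hL : ∀ x ∈ L.carrier, x ∈ V) (h : K ⊔ L ≠ ⊤) :
    ∀ x ∈ (K ⊔ L).carrier, x ∈ V := by
  obtain ⟨u, hu, -⟩ := exists_halfspace_of_notMem (fun h0 => h (eq_top_iff_zero_mem.2 h0))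
  let M : PC n := ofSet (V ∩ (halfspace u).carrier)
    (V.closed_of_finiteDimensional.inter (halfspace u).isClosed)
    (V.convex.inter (halfspace u).convex)
    (fun h => halfspace_ne_top u (eq_top_iff_zero_mem.2 h.2))
    (fun x hx c hc => ⟨V.smul_mem c hx.1, (halfspace u).smul_mem hx.2 hc⟩)
  have hM : K ⊔ L ≤ M := sup_le (fun x hx => ⟨hK x hx, hu (le_sup_left (a := K) hx)⟩)
    (fun x hx => ⟨hL x hx, hu (le_sup_right (b := L) hx)⟩)
  exact fun x hx => (hM hx).1

theorem dim_sup_ray_le {K : PC n} {y : Euc n} (hy : y ∉ Submodule.span ℝ K.carrier) :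
    (K ⊔ ray y).dim ≤ K.dim + 1 ∧
      ∀ x ∈ (K ⊔ ray y).carrier, x ∈ Submodule.span ℝ K.carrier ⊔ Submodule.span ℝ {y} := by
  have hy0 : y ≠ 0 := fun h => hy (h ▸ Submodule.zero_mem _)
  have h := subset_of_sup_ne_top (K := K) (L := ray y)
    (V := Submodule.span ℝ K.carrier ⊔ Submodule.span ℝ {y})
    (fun x hx => Submodule.mem_sup_left (Submodule.subset_span hx))
    (fun x hx => by
      obtain ⟨c, -, rfl⟩ := (mem_ray hy0).1 hx
      exact Submodule.mem_sup_right (Submodule.smul_mem _ _ (Submodule.mem_span_singleton_self y)))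
    (sup_ray_ne_top (fun x hx => Submodule.subset_span hx) hy)
  refine ⟨?_, h⟩
  calc (K ⊔ ray y).dim ≤ Module.finrank ℝ
        ↥(Submodule.span ℝ K.carrier ⊔ Submodule.span ℝ {y}) :=
        Submodule.finrank_mono (Submodule.span_le.2 h)
    _ ≤ _ := Submodule.finrank_add_le_finrank_add_finrank _ _
    _ = K.dim + 1 := by rw [finrank_span_singleton hy0]; rfl

theorem exists_family_sup_ray (K : PC n) (hK : K.dim + 2 ≤ n) :
    ∃ y : ℝ → Euc n, (∀ r, y r ∉ Submodule.span ℝ K.carrier) ∧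
      ∀ r q, r ≠ q → (K ⊔ ray (y r)) ⊓ (K ⊔ ray (y q)) = K := by
  set V := Submodule.span ℝ K.carrier with hV
  have hdim : K.dim = Module.finrank ℝ V := rfl
  obtain ⟨y, hy⟩ : ∃ y, y ∉ V := by
    by_contra! hcon
    rw [Submodule.eq_top_iff'.2 hcon, finrank_top, finrank_euclideanSpace_fin] at hdim
    omega
  have hy0 : y ≠ 0 := fun h => hy (h ▸ Submodule.zero_mem _)
  obtain ⟨z, hz⟩ : ∃ z, z ∉ V ⊔ Submodule.span ℝ {y} := by
    by_contra! hcon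
    have h1 := Submodule.finrank_add_le_finrank_add_finrank V (Submodule.span ℝ {y})
    rw [Submodule.eq_top_iff'.2 hcon, finrank_span_singleton hy0, finrank_top,
      finrank_euclideanSpace_fin] at h1
    omega
  obtain ⟨f, hf, hfz⟩ := exists_clm_le_ker_eq_one hz
  obtain ⟨g, hg, hgy⟩ := exists_clm_le_ker_eq_one hy
  have hfV : ∀ v ∈ V, f v = 0 := fun v hv => hf v (Submodule.mem_sup_left hv)
  have hfy : f y = 0 := hf y (Submodule.mem_sup_right (Submodule.mem_span_singleton_self y))
  have hnot : ∀ r : ℝ, y + r • z ∉ V := by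
    intro r hr
    have h1 := hfV _ hr
    have h2 := hg _ hr
    simp only [map_add, map_smul, hfy, hfz, smul_eq_mul, mul_one, zero_add] at h1
    simp [h1, hgy] at h2
  -- `y` and `z` are independent modulo `V`, so the spaces spanned by `V` and `y + r • z` meet
  -- pairwise in `V` only.
  refine ⟨fun r => y + r • z, hnot, fun r q hrq => le_antisymm ?_ (le_inf le_sup_left le_sup_left)⟩
  rintro p ⟨h1, h2⟩
  refine mem_of_mem_sup_ray (fun x hx => Submodule.subset_span hx) (hnot r) h1 ?_
  obtain ⟨v, hv, w, hw, hp⟩ := Submodule.mem_sup.1 ((dim_sup_ray_le (hnot r)).2 p h1)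
  obtain ⟨v', hv', w', hw', hp'⟩ := Submodule.mem_sup.1 ((dim_sup_ray_le (hnot q)).2 p h2)
  obtain ⟨a, rfl⟩ := Submodule.mem_span_singleton.1 hw
  obtain ⟨b, rfl⟩ := Submodule.mem_span_singleton.1 hw'
  have e1 : a * r = b * q := by
    have h3 := congrArg f hp
    rw [← hp'] at h3
    simpa [hfV v hv, hfV v' hv', hfy, hfz] using h3
  have e2 : a * (1 + r * g z) = b * (1 + q * g z) := by
    have h3 := congrArg g hp
    rw [← hp'] at h3
    simpa [hg v hv, hg v' hv', hgy, mul_add] using h3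
  have e3 : a = b := by linear_combination e2 - g z * e1
  have e4 : a = 0 := by
    rw [← e3] at e1
    have : a * (r - q) = 0 := by linear_combination e1
    exact (mul_eq_zero.1 this).resolve_right (sub_ne_zero.2 hrq)
  rw [← hp, e4, zero_smul, add_zero]
  exact hv

/-- Downward induction on `k`. At `k = n - 2` the bound is `dim_le_sub_two`; below it, adjoining a
ray raises the dimension of `K` by at most one and, for some direction, that of `φ K` by at least
one. -/
theorem dim_map_le (hn : 2 ≤ n) (φ : LatticeHom (PC n) (PC n)) (hφ : Function.Injective φ) (m : ℕ) :
    ∀ k, k + m = n - 2 → ∀ K : PC n, K.dim ≤ k → (φ K).dim ≤ k := by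
  induction m with
  | zero =>
    intro k hk K hK
    obtain ⟨y, hy, hy2⟩ := exists_family_sup_ray K (by omega)
    have := dim_le_sub_two hn (φ K) (fun r => φ (K ⊔ ray (y r)))
      (fun r q hrq => by rw [← map_inf, hy2 r q hrq]) (fun r h => hy r (by
        have h2 : ray (y r) ≤ K := by
          rw [← hφ h]
          exact le_sup_right
        exact Submodule.subset_span (ray_le_iff.1 h2)))
    omega
  | succ m ih =>
    intro k hk K hK
    obtain ⟨y, hy, hy2⟩ := exists_family_sup_ray K (by omega)
    obtain ⟨r, hr⟩ := exists_dim_lt hn (φ K) (fun r => φ (K ⊔ ray (y r)))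
      (fun r q hrq => by rw [← map_inf, hy2 r q hrq]) (fun r h => hy r (by
        have h2 : ray (y r) ≤ K := by
          rw [← hφ h]
          exact le_sup_right
        exact Submodule.subset_span (ray_le_iff.1 h2)))
    have h1 := (dim_sup_ray_le (hy r)).1
    have h2 := ih (k + 1) (by omega) (K ⊔ ray (y r)) (by omega)
    omega

theorem map_bot_eq_bot (hn : 2 ≤ n) (φ : LatticeHom (PC n) (PC n)) (hφ : Function.Injective φ) :
    φ ⊥ = ⊥ := by
  have := dim_map_le hn φ hφ (n - 2) 0 (by omega) ⊥ dim_bot.le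
  exact eq_bot_of_dim_eq_zero hn (by omega)

/-! ### Images of rays are rays. -/

theorem subset_hull_of_ne_top {K L : PC n} (h : K ⊔ L ≠ ⊤) : (K ⊔ L).carrier ⊆ hull K L := by
  have h1 : (K ⊔ L).carrier = joinSet K L := rfl
  rw [h1]
  unfold joinSet
  split_ifs with h0
  · refine absurd (eq_top_iff_zero_mem.2 ?_) h
    rw [h1]
    exact hull_subset_joinSet K L h0
  · exact subset_rfl

/-- A segment from the interior of `D` to a point `p` of `R` outside `D` leaves `D` at a point
interior to `R`. Near it, `M` and `N` lie in `D`, so a functional supporting `D` there also supports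
`M` and `N`, hence their join, but `p` lies beyond it. -/
theorem le_of_interior_nonempty {D R M N : PC n} (hD : (interior D.carrier).Nonempty)
    (hM : M ⊓ R = D) (hN : N ⊓ R = D) (hR : R ≤ M ⊔ N) (hT : M ⊔ N ≠ ⊤) : R ≤ D := by
  obtain ⟨c, hc⟩ := hD
  have hDR : D ≤ R := hM ▸ inf_le_right
  intro p hp
  by_contra hpD
  let γ : ℝ → Euc n := fun t => AffineMap.lineMap c p t
  have hγ : Continuous γ := AffineMap.lineMap_continuous
  have hγ' : ∀ t, γ t = (1 - t) • c + t • p := fun t => AffineMap.lineMap_apply_module c p t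
  let S := Set.Icc (0 : ℝ) 1 ∩ γ ⁻¹' D.carrier
  have hS : IsCompact S := isCompact_Icc.inter_right (D.isClosed.preimage hγ)
  have hS0 : S.Nonempty := ⟨0, by simp, by simpa [γ] using interior_subset hc⟩
  obtain ⟨⟨hτ0, hτ1⟩, hτD⟩ := hS.sSup_mem hS0
  set τ := sSup S with hτ
  have hτlt : τ < 1 := by
    refine lt_of_le_of_ne hτ1 fun h => hpD ?_
    have : γ τ ∈ D.carrier := hτD
    simpa [γ, h] using this
  have hwD : γ τ ∉ interior D.carrier := by
    intro hint
    have hopen : IsOpen (γ ⁻¹' interior D.carrier) := isOpen_interior.preimage hγ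
    have hev : ∀ᶠ t in nhdsWithin τ (Set.Ioi τ), t ∈ γ ⁻¹' interior D.carrier :=
      nhdsWithin_le_nhds (hopen.mem_nhds hint)
    obtain ⟨t, ht, ht1, ht2⟩ := (hev.and (Ioc_mem_nhdsGT hτlt)).exists
    have : t ≤ τ := le_csSup hS.bddAbove ⟨⟨hτ0.trans ht1.le, ht2⟩, interior_subset (s := D.carrier) ht⟩
    linarith
  have hwR : γ τ ∈ interior R.carrier := by
    rw [hγ']
    exact R.convex.combo_interior_self_mem_interior (interior_mono hDR hc) hp (by linarith) hτ0
      (by ring)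
  obtain ⟨g, hg⟩ := geometric_hahn_banach_open_point D.convex.interior isOpen_interior hwD
  have hgD : ∀ d ∈ D.carrier, g d ≤ g (γ τ) := by
    intro d hd
    have h1 : d ∈ closure (interior D.carrier) := by
      rw [D.convex.closure_interior_eq_closure_of_nonempty_interior ⟨c, hc⟩]
      exact subset_closure hd
    exact closure_minimal (fun a ha => (hg a ha).le) (isClosed_le g.continuous continuous_const) h1
  have hgM : ∀ M : PC n, M ⊓ R = D → ∀ m ∈ M.carrier, g m ≤ g (γ τ) := by
    intro M hM m hm
    have hwM : γ τ ∈ M.carrier := (hM ▸ inf_le_left : D ≤ M) hτD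
    have hcont : Continuous fun δ : ℝ => (1 - δ) • γ τ + δ • m := by fun_prop
    have hopen := (isOpen_interior (s := R.carrier)).preimage hcont
    have hev : ∀ᶠ δ in nhdsWithin (0 : ℝ) (Set.Ioi 0),
        δ ∈ (fun δ : ℝ => (1 - δ) • γ τ + δ • m) ⁻¹' interior R.carrier :=
      nhdsWithin_le_nhds (hopen.mem_nhds (by simpa using hwR))
    obtain ⟨δ, hδ, hδ0, hδ1⟩ := (hev.and (Ioc_mem_nhdsGT zero_lt_one)).exists
    have h1 : (1 - δ) • γ τ + δ • m ∈ D.carrier := by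
      rw [← hM]
      exact ⟨M.convex hwM hm (by linarith) hδ0.le (by ring), interior_subset hδ⟩
    have h2 := hgD _ h1
    simp only [map_add, map_smul, smul_eq_mul] at h2
    nlinarith
  have hhull : hull M N ⊆ {x | g x ≤ g (γ τ)} :=
    closure_minimal (convexHull_min (Set.union_subset (hgM M hM) (hgM N hN))
      (convex_halfSpace_le g.isLinear _)) (isClosed_le g.continuous continuous_const)
  have h1 : g p ≤ g (γ τ) := hhull (subset_hull_of_ne_top hT (hR hp))
  have h2 := hg c hc
  rw [hγ'] at h1 h2
  simp only [map_add, map_smul, smul_eq_mul] at h1 h2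
  nlinarith

/-- Shows that the property in `le_of_interior_nonempty` fails for rays. Two half-spaces whose
boundaries cross at `x` both cut `ray (x/2)` down to `ray x`, while `x/2` is the midpoint of `(x +
y)/2` and `(x - y)/2`, one in each. The cut by `v` keeps the join proper. -/
theorem exists_inf_eq_ray {x y : Euc n} (h : LinearIndependent ℝ ![x, y]) :
    ∃ M N R : PC n, M ⊓ R = ray x ∧ N ⊓ R = ray x ∧ R ≤ M ⊔ N ∧ M ⊔ N ≠ ⊤ ∧ ¬ R ≤ ray x := by
  have hx := (linearIndependent_pair_ne_zero h).1
  obtain ⟨u, hux, huy⟩ := exists_clm_pair h 1 1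
  obtain ⟨u', hux', huy'⟩ := exists_clm_pair h 1 (-1)
  obtain ⟨v, hvx, hvy⟩ := exists_clm_pair h 2 0
  have hx2 : (2⁻¹ : ℝ) • x ≠ 0 := smul_ne_zero (by norm_num) hx
  have hcut : ∀ w : Euc n →L[ℝ] ℝ, w x = 1 →
      halfspace w ⊓ halfspace v ⊓ ray ((2⁻¹ : ℝ) • x) = ray x := by
    intro w hw
    apply le_antisymm
    · rintro p ⟨⟨h1, -⟩, h2⟩
      obtain ⟨c, hc, rfl⟩ := (mem_ray hx2).1 h2
      rw [mem_halfspace, smul_smul, map_smul, hw, smul_eq_mul, mul_one] at h1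
      rwa [smul_smul, smul_mem_ray_iff hx]
    · rw [ray_le_iff]
      refine ⟨⟨hw.ge, ?_⟩, ?_⟩
      · rw [mem_halfspace, hvx]
        norm_num
      · exact (mem_ray hx2).2 ⟨2, by norm_num, by simp⟩
  refine ⟨halfspace u ⊓ halfspace v, halfspace u' ⊓ halfspace v, ray ((2⁻¹ : ℝ) • x), hcut u hux,
    hcut u' hux', ?_, ?_, ?_⟩
  · rw [ray_le_iff]
    set P := halfspace u ⊓ halfspace v ⊔ halfspace u' ⊓ halfspace v
    have h1 : (2⁻¹ : ℝ) • x + (2⁻¹ : ℝ) • y ∈ P.carrier := by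
      refine (le_sup_left : halfspace u ⊓ halfspace v ≤ P) ⟨?_, ?_⟩ <;>
      simp only [mem_halfspace, map_add, map_smul, hux, huy, hvx, hvy, smul_eq_mul] <;> norm_num
    have h2 : (2⁻¹ : ℝ) • x - (2⁻¹ : ℝ) • y ∈ P.carrier := by
      refine (le_sup_right : halfspace u' ⊓ halfspace v ≤ P) ⟨?_, ?_⟩ <;>
      simp only [mem_halfspace, map_sub, map_smul, hux', huy', hvx, hvy, smul_eq_mul] <;> norm_num
    have h3 := P.convex h1 h2 (a := 2⁻¹) (b := 2⁻¹) (by norm_num) (by norm_num) (by norm_num)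
    convert h3 using 1
    module
  · intro hT
    have hle : halfspace u ⊓ halfspace v ⊔ halfspace u' ⊓ halfspace v ≤ halfspace v :=
      sup_le inf_le_right inf_le_right
    exact halfspace_ne_top v (top_le_iff.1 (hT ▸ hle))
  · rw [ray_le_iff, smul_mem_ray_iff hx]
    norm_num

theorem dim_ray_le_one {x : Euc n} (hx : x ≠ 0) : (ray x).dim ≤ 1 := by
  rw [← finrank_span_singleton (K := ℝ) hx]
  refine Submodule.finrank_mono (Submodule.span_le.2 fun p hp => ?_)
  obtain ⟨c, -, rfl⟩ := (mem_ray hx).1 hp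
  exact Submodule.smul_mem _ _ (Submodule.mem_span_singleton_self x)

theorem interior_nonempty_of_dim_eq (K : PC n) (hne : K.carrier.Nonempty) (hK : K.dim = n) :
    (interior K.carrier).Nonempty := by
  obtain ⟨c, -, δ, hδ, hball⟩ := exists_ball_subset K hne
  have hT : Submodule.span ℝ K.carrier = ⊤ :=
    Submodule.eq_top_of_finrank_eq (hK.trans finrank_euclideanSpace_fin.symm)
  refine ⟨c, mem_interior_iff_mem_nhds.2 (Metric.mem_nhds_iff.2 ⟨δ, hδ, fun v hv => ?_⟩)⟩
  have := hball (v - c) (hT ▸ Submodule.mem_top) (by rwa [← dist_eq_norm])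
  rwa [add_sub_cancel] at this

theorem map_ne_top_of_ne_top (φ : LatticeHom (PC n) (PC n)) (hφ : Function.Injective φ) {K : PC n}
    (hK : K ≠ ⊤) : φ K ≠ ⊤ := fun h =>
  hK (hφ (le_antisymm (OrderHomClass.mono φ le_top) (le_top.trans_eq h.symm)))

theorem dim_map_ray_le_one (hn : 2 ≤ n) (φ : LatticeHom (PC n) (PC n)) (hφ : Function.Injective φ)
    {x : Euc n} (hx : x ≠ 0) : (φ (ray x)).dim ≤ 1 := by
  obtain rfl | hn3 := hn.eq_or_lt
  · by_contra! hcon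
    have hdim : (φ (ray x)).dim = 2 := le_antisymm (dim_le _) hcon
    have hne : (φ (ray x)).carrier.Nonempty := by
      rw [Set.nonempty_iff_ne_empty]
      intro h
      have hb : φ (ray x) = ⊥ := carrier_injective h
      rw [hb, dim_bot] at hdim
      omega
    obtain ⟨y, hxy⟩ := exists_linearIndependent_pair le_rfl hx
    obtain ⟨M, N, R, h1, h2, h3, h4, h5⟩ := exists_inf_eq_ray hxy
    have := le_of_interior_nonempty (R := φ R) (M := φ M) (N := φ N)
      (interior_nonempty_of_dim_eq _ hne hdim)
      (by rw [← map_inf, h1]) (by rw [← map_inf, h2])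
      (by rw [← map_sup]; exact OrderHomClass.mono φ h3)
      (by rw [← map_sup]; exact map_ne_top_of_ne_top φ hφ h4)
    refine h5 (inf_eq_left.1 (hφ ?_))
    rw [map_inf, inf_eq_left.2 this]
  · exact dim_map_le hn φ hφ (n - 3) 1 (by omega) _ (dim_ray_le_one hx)

theorem exists_eq_ray {K : PC n} (hb : K ≠ ⊥) (hT : K ≠ ⊤) (hd : K.dim ≤ 1) :
    ∃ p, p ≠ 0 ∧ K = ray p := by
  have h0 : (0 : Euc n) ∉ K.carrier := fun h => hT (eq_top_iff_zero_mem.2 h)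
  obtain ⟨p, hp⟩ : ∃ p, p ∈ K.carrier := by
    by_contra! hcon
    exact hb (eq_bot_iff_forall.2 hcon)
  have hp0 : p ≠ 0 := fun h => h0 (h ▸ hp)
  have hspan : Submodule.span ℝ {p} = Submodule.span ℝ K.carrier :=
    Submodule.eq_of_le_of_finrank_le (Submodule.span_mono (by simpa using hp))
      (by rw [finrank_span_singleton hp0]; exact hd)
  let S : Set ℝ := {t | t • p ∈ K.carrier}
  have hSc : IsClosed S := K.isClosed.preimage (by fun_prop : Continuous fun t : ℝ => t • p)
  have hS0 : ∀ t ∈ S, 0 < t := by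
    intro t ht
    by_contra! hneg
    have := K.convex hp ht (a := -t / (1 - t)) (b := 1 / (1 - t))
      (div_nonneg (by linarith) (by linarith)) (div_nonneg (by linarith) (by linarith))
      (by rw [← add_div]; exact (div_eq_one_iff_eq (by linarith)).2 (by ring))
    rw [smul_smul, ← add_smul, show -t / (1 - t) + 1 / (1 - t) * t = 0 by ring, zero_smul] at this
    exact h0 this
  have hSb : BddBelow S := ⟨0, fun t ht => (hS0 t ht).le⟩
  have hm : sInf S ∈ S := hSc.csInf_mem ⟨1, by simpa [S] using hp⟩ hSb
  have hpos := hS0 _ hm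
  refine ⟨sInf S • p, smul_ne_zero hpos.ne' hp0, le_antisymm (fun q hq => ?_) (ray_le_iff.2 hm)⟩
  obtain ⟨t, rfl⟩ := Submodule.mem_span_singleton.1 (hspan ▸ Submodule.subset_span hq)
  exact ray_smul_le_ray_smul hpos (csInf_le hSb hq) (self_mem_ray _)

theorem exists_map_ray_eq_ray (hn : 2 ≤ n) (φ : LatticeHom (PC n) (PC n))
    (hφ : Function.Injective φ) {x : Euc n} (hx : x ≠ 0) : ∃ p, p ≠ 0 ∧ φ (ray x) = ray p := by
  refine exists_eq_ray (fun h => ?_) (map_ne_top_of_ne_top φ hφ (ray_ne_top hx))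
    (dim_map_ray_le_one hn φ hφ hx)
  exact notMem_bot x (hφ (h.trans (map_bot_eq_bot hn φ hφ).symm) ▸ self_mem_ray x)

theorem map_le_map_iff_of_injective (φ : LatticeHom (PC n) (PC n)) (hφ : Function.Injective φ)
    {K L : PC n} : φ K ≤ φ L ↔ K ≤ L := by
  refine ⟨fun h => inf_eq_left.1 (hφ ?_), fun h => OrderHomClass.mono φ h⟩
  rw [map_inf, inf_eq_left.2 h]

/-- A negative coefficient would be exposed by a half-space that contains both rays and whose
functional is very large at the corresponding generator. -/
theorem exists_combo_of_mem_ray_sup_ray {a b p : Euc n} (h : LinearIndependent ℝ ![a, b])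
    (hp : p ∈ (ray a ⊔ ray b).carrier) : ∃ s t : ℝ, 0 ≤ s ∧ 0 ≤ t ∧ p = s • a + t • b := by
  obtain ⟨ha, hb⟩ := linearIndependent_pair_ne_zero h
  have hspan : p ∈ Submodule.span ℝ {a, b} := by
    refine subset_of_sup_ne_top (fun x hx => ?_) (fun x hx => ?_) (ray_sup_ray_ne_top h) p hp
    · obtain ⟨c, -, rfl⟩ := (mem_ray ha).1 hx
      exact Submodule.smul_mem _ _ (Submodule.subset_span (by simp))
    · obtain ⟨c, -, rfl⟩ := (mem_ray hb).1 hx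
      exact Submodule.smul_mem _ _ (Submodule.subset_span (by simp))
  obtain ⟨s, t, rfl⟩ := Submodule.mem_span_pair.1 hspan
  have key : ∀ α β : ℝ, 1 ≤ α → 1 ≤ β → 1 ≤ s * α + t * β := by
    intro α β hα hβ
    obtain ⟨u, hua, hub⟩ := exists_clm_pair h α β
    have hle : ray a ⊔ ray b ≤ halfspace u :=
      sup_le (ray_le_iff.2 (by rwa [mem_halfspace, hua])) (ray_le_iff.2 (by rwa [mem_halfspace, hub]))
    have h1 : 1 ≤ u (s • a + t • b) := hle hp
    simpa [hua, hub] using h1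
  refine ⟨s, t, ?_, ?_, rfl⟩
  · by_contra! hs
    have h1 := key (1 + |t| / -s) 1
      (by have := div_nonneg (abs_nonneg t) (neg_nonneg.2 hs.le); linarith) le_rfl
    rw [mul_add, mul_div_assoc', div_neg, mul_div_cancel_left₀ _ hs.ne] at h1
    linarith [le_abs_self t]
  · by_contra! ht
    have h1 := key 1 (1 + |s| / -t) le_rfl
      (by have := div_nonneg (abs_nonneg s) (neg_nonneg.2 ht.le); linarith)
    rw [mul_add, mul_div_assoc', div_neg, mul_div_cancel_left₀ _ ht.ne] at h1
    linarith [le_abs_self s]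

theorem ray_inf_ray_neg {x : Euc n} (hx : x ≠ 0) : ray x ⊓ ray (-x) = ⊥ := by
  rw [eq_bot_iff_forall]
  rintro z ⟨h1, h2⟩
  obtain ⟨c, hc, rfl⟩ := (mem_ray hx).1 h1
  obtain ⟨d, hd, h⟩ := (mem_ray (neg_ne_zero.2 hx)).1 h2
  rw [smul_neg, ← neg_smul] at h
  have := smul_left_injective ℝ hx h
  linarith

theorem linearIndependent_pair_neg_right {x y : Euc n} (h : LinearIndependent ℝ ![x, y]) :
    LinearIndependent ℝ ![x, -y] := by
  rw [LinearIndependent.pair_iff] at h ⊢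
  intro s t hst
  have := h s (-t) (by rw [← hst]; module)
  exact ⟨this.1, by linarith [this.2]⟩

/-! ### The induced point map and its linearity. -/

/-- A point map `f` inducing the injective endomorphism `φ` on rays. -/
structure InducesOnRays (φ : LatticeHom (PC n) (PC n)) (f : Euc n → Euc n) : Prop where
  injective : Function.Injective φ
  map_bot : φ ⊥ = ⊥
  ne_zero : ∀ x, x ≠ 0 → f x ≠ 0
  map_ray : ∀ x, x ≠ 0 → φ (ray x) = ray (f x)

namespace InducesOnRays

variable {φ : LatticeHom (PC n) (PC n)} {f : Euc n → Euc n}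

theorem mem_iff (h : InducesOnRays φ f) {x : Euc n} (hx : x ≠ 0) {K : PC n} :
    f x ∈ (φ K).carrier ↔ x ∈ K.carrier := by
  rw [← ray_le_iff, ← h.map_ray x hx, map_le_map_iff_of_injective φ h.injective, ray_le_iff]

theorem pair (h : InducesOnRays φ f) {x y : Euc n} (hxy : LinearIndependent ℝ ![x, y]) :
    LinearIndependent ℝ ![f x, f y] := by
  obtain ⟨hx, hy⟩ := linearIndependent_pair_ne_zero hxy
  refine linearIndependent_of_rays (h.ne_zero x hx) (h.ne_zero y hy) ?_ ?_
  · rw [← h.map_ray x hx, ← h.map_ray y hy, ← map_inf, ray_inf_ray_eq_bot hxy, h.map_bot]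
  · rw [← h.map_ray x hx, ← h.map_ray y hy, ← map_sup]
    exact map_ne_top_of_ne_top φ h.injective (ray_sup_ray_ne_top hxy)

theorem ray_inf_ray_map_neg (h : InducesOnRays φ f) {x : Euc n} (hx : x ≠ 0) :
    ray (f x) ⊓ ray (f (-x)) = ⊥ := by
  rw [← h.map_ray x hx, ← h.map_ray (-x) (neg_ne_zero.2 hx), ← map_inf, ray_inf_ray_neg hx,
    h.map_bot]

theorem ray_sup_ray_map_neg (h : InducesOnRays φ f) {x : Euc n} (hx : x ≠ 0) :
    ray (f x) ⊔ ray (f (-x)) = φ ⊤ := by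
  rw [← h.map_ray x hx, ← h.map_ray (-x) (neg_ne_zero.2 hx), ← map_sup, ray_sup_ray_neg]

/-- If `φ ⊤` were proper, it would lie in the sector spanned by the independent vectors `f x` and `f
(-x)`, for every `x ≠ 0`. Then `f x` would be a nonnegative combination of `f y` and `f (-y)`, which
lie in the sector where `f x` is extreme, so `f x` would be parallel to one of them. -/
theorem map_top (h : InducesOnRays φ f) {x y : Euc n} (hxy : LinearIndependent ℝ ![x, y]) :
    φ ⊤ = ⊤ := by
  by_contra hT
  obtain ⟨hx, hy⟩ := linearIndependent_pair_ne_zero hxy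
  have hli : ∀ x : Euc n, x ≠ 0 → LinearIndependent ℝ ![f x, f (-x)] := fun x hx =>
    linearIndependent_of_rays (h.ne_zero x hx) (h.ne_zero _ (neg_ne_zero.2 hx))
      (h.ray_inf_ray_map_neg hx) (by rwa [h.ray_sup_ray_map_neg hx])
  have hrep : ∀ x z : Euc n, x ≠ 0 → z ≠ 0 →
      ∃ s t : ℝ, 0 ≤ s ∧ 0 ≤ t ∧ f z = s • f x + t • f (-x) := fun x z hx hz =>
    exists_combo_of_mem_ray_sup_ray (hli x hx)
      (by rw [h.ray_sup_ray_map_neg hx]; exact (h.mem_iff hz).2 (mem_top z))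
  obtain ⟨a, b, ha, hb, e1⟩ := hrep y x hy hx
  obtain ⟨c, d, hc, hd, e2⟩ := hrep x y hx hy
  obtain ⟨c', d', hc', hd', e3⟩ := hrep x (-y) hx (neg_ne_zero.2 hy)
  have e4 := LinearIndependent.pair_iff.1 (hli x hx) (a * c + b * c' - 1) (a * d + b * d') (by
    have e5 : f x = a • (c • f x + d • f (-x)) + b • (c' • f x + d' • f (-x)) := by
      rw [← e2, ← e3]
      exact e1
    rw [← sub_eq_zero] at e5
    rw [← neg_eq_zero, ← e5]
    module)
  have h1 : a * d = 0 := by nlinarith [mul_nonneg ha hd, mul_nonneg hb hd']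
  rcases mul_eq_zero.1 h1 with h2 | h2
  · have := LinearIndependent.pair_iff.1 (h.pair (linearIndependent_pair_neg_right hxy)) 1 (-b)
      (by rw [e1, h2]; module)
    simp at this
  · have := LinearIndependent.pair_iff.1 (h.pair hxy) (-c) 1 (by rw [e2, h2]; module)
    simp at this

theorem map_neg (h : InducesOnRays φ f) (hT : φ ⊤ = ⊤) {y : Euc n} (hy : y ≠ 0) :
    ∃ c : ℝ, 0 < c ∧ f (-y) = (-c) • f y := by
  have h1 : ¬ LinearIndependent ℝ ![f y, f (-y)] := fun hli =>
    ray_sup_ray_ne_top hli (by rw [h.ray_sup_ray_map_neg hy, hT])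
  have hfy := h.ne_zero y hy
  have hfy' := h.ne_zero (-y) (neg_ne_zero.2 hy)
  rw [LinearIndependent.pair_iff' hfy] at h1
  push Not at h1
  obtain ⟨a, ha⟩ := h1
  refine ⟨-a, ?_, by rw [neg_neg, ha]⟩
  by_contra! hneg
  have ha0 : a ≠ 0 := by
    rintro rfl
    rw [zero_smul] at ha
    exact hfy' ha.symm
  have hpos : 0 < a := lt_of_le_of_ne (by linarith) ha0.symm
  refine eq_bot_iff_forall.1 (h.ray_inf_ray_map_neg hy) ((1 + a) • f y)
    ⟨(smul_mem_ray_iff hfy).2 (by linarith), (mem_ray hfy').2 ⟨(1 + a) / a, ?_, ?_⟩⟩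
  · rw [le_div_iff₀ hpos]
    linarith
  · rw [← ha, smul_smul, div_mul_cancel₀ _ ha0]

/-- A half-space containing `φ (halfspace u)` but not this point has a functional positive at `f y`.
Rescaled, it contains `ray (f y)` too, although the join of the two is `φ ⊤ = ⊤`. -/
theorem sub_smul_mem (h : InducesOnRays φ f) (hT : φ ⊤ = ⊤) {u : Euc n →L[ℝ] ℝ} {x y : Euc n}
    (hx : u x = 1) (hy : u y = 0) (hy0 : y ≠ 0) {c : ℝ} (hc : 0 ≤ c) :
    f x - c • f y ∈ (φ (halfspace u)).carrier := by
  have hx0 : x ≠ 0 := by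
    rintro rfl
    simp at hx
  by_contra hnot
  obtain ⟨v, hv, hvq⟩ := exists_halfspace_of_notMem hnot
  have hvx : 1 ≤ v (f x) := hv ((h.mem_iff hx0).2 hx.ge)
  rw [map_sub, map_smul, smul_eq_mul] at hvq
  have hvy : 0 < v (f y) := by
    by_contra! hneg
    nlinarith
  have hle : φ (halfspace u ⊔ ray y) ≤ halfspace ((1 + (v (f y))⁻¹) • v) := by
    rw [map_sup, h.map_ray y hy0]
    refine sup_le (fun m hm => ?_) (ray_le_iff.2 ?_)
    · have h1 : 1 ≤ v m := hv hm
      have := inv_pos.2 hvy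
      simp only [mem_halfspace, smul_apply, smul_eq_mul]
      nlinarith
    · simp only [mem_halfspace, smul_apply, smul_eq_mul, add_mul, inv_mul_cancel₀ hvy.ne']
      linarith
  rw [halfspace_sup_ray hx hy, hT] at hle
  exact halfspace_ne_top _ (top_le_iff.1 hle)

theorem add_smul_mem (h : InducesOnRays φ f) (hT : φ ⊤ = ⊤) {u : Euc n →L[ℝ] ℝ} {x y : Euc n}
    (hx : u x = 1) (hy : u y = 0) (hy0 : y ≠ 0) (c : ℝ) :
    f x + c • f y ∈ (φ (halfspace u)).carrier := by
  rcases le_total c 0 with hc | hc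
  · have := h.sub_smul_mem hT hx hy hy0 (neg_nonneg.2 hc)
    rwa [neg_smul, sub_neg_eq_add] at this
  · obtain ⟨d, hd, hfd⟩ := h.map_neg hT hy0
    have := h.sub_smul_mem hT (y := -y) hx (by rw [_root_.map_neg, hy, neg_zero])
      (neg_ne_zero.2 hy0) (div_nonneg hc hd.le)
    rwa [hfd, smul_smul, mul_neg, div_mul_cancel₀ _ hd.ne', neg_smul, sub_neg_eq_add] at this

/-- `halfspace u` cuts `ray (z/2)` down to `ray z`, and `f z` lies strictly beyond `f (z/2)` on its
ray. If `t < 1`, convexity would put a point of `φ (ray (z/2))` just short of `f z` into `φ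
(halfspace u)`, hence into `ray (f z)`. -/
theorem one_le_of_smul_mem (h : InducesOnRays φ f) {u : Euc n →L[ℝ] ℝ} {z : Euc n}
    (hz : u z = 1) {t : ℝ} (ht : t • f z ∈ (φ (halfspace u)).carrier) : 1 ≤ t := by
  have hz0 : z ≠ 0 := by
    rintro rfl
    simp at hz
  have hz2 : (2⁻¹ : ℝ) • z ≠ 0 := smul_ne_zero (by norm_num) hz0
  by_contra! hlt
  have hfz := h.ne_zero z hz0
  have hw := h.ne_zero _ hz2
  obtain ⟨κ, hκ1, hκ⟩ := (mem_ray hw).1 (by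
    rw [← h.map_ray _ hz2, h.mem_iff hz0]
    exact (mem_ray hz2).2 ⟨2, by norm_num, by simp⟩ : f z ∈ (ray (f ((2⁻¹ : ℝ) • z))).carrier)
  have hκ0 : 0 < κ := by linarith
  have hfz_mem : f z ∈ (φ (halfspace u)).carrier := (h.mem_iff hz0).2 hz.ge
  have hκne : κ ≠ 1 := by
    rintro rfl
    rw [one_smul] at hκ
    have h1 : (2⁻¹ : ℝ) • z ∈ (ray z).carrier := by
      rw [← h.mem_iff hz2, hκ, h.mem_iff hz0]
      exact self_mem_ray z
    rw [smul_mem_ray_iff hz0] at h1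
    norm_num at h1
  have hκ' : κ⁻¹ < 1 := inv_lt_one_of_one_lt₀ (lt_of_le_of_ne hκ1 hκne.symm)
  obtain ⟨s, hts, hκs, hs1⟩ : ∃ s, t ≤ s ∧ κ⁻¹ ≤ s ∧ s < 1 :=
    ⟨max t κ⁻¹, le_max_left _ _, le_max_right _ _, max_lt hlt hκ'⟩
  have h1t : 0 < 1 - t := by linarith
  have hs : s • f z ∈ (φ (halfspace u)).carrier := by
    have h1 := (φ (halfspace u)).convex ht hfz_mem (a := (1 - s) / (1 - t)) (b := (s - t) / (1 - t))
      (div_nonneg (by linarith) h1t.le) (div_nonneg (by linarith) h1t.le)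
      (by rw [← add_div]; exact (div_eq_one_iff_eq h1t.ne').2 (by ring))
    rw [smul_smul, ← add_smul] at h1
    convert h1 using 2
    field_simp
    ring
  have hs' : s • f z ∈ (φ (ray ((2⁻¹ : ℝ) • z))).carrier := by
    rw [h.map_ray _ hz2]
    refine (mem_ray hw).2 ⟨s * κ, ?_, by rw [← hκ, smul_smul]⟩
    calc (1 : ℝ) = κ⁻¹ * κ := (inv_mul_cancel₀ hκ0.ne').symm
      _ ≤ s * κ := by gcongr
  have hcut : halfspace u ⊓ ray ((2⁻¹ : ℝ) • z) ≤ ray z := by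
    rintro p ⟨h1, h2⟩
    obtain ⟨c, hc, rfl⟩ := (mem_ray hz2).1 h2
    rw [mem_halfspace, smul_smul, _root_.map_smul, hz, smul_eq_mul, mul_one] at h1
    rwa [smul_smul, smul_mem_ray_iff hz0]
  have h2 : s • f z ∈ (φ (ray z)).carrier := by
    refine OrderHomClass.mono φ hcut ?_
    rw [map_inf]
    exact ⟨hs, hs'⟩
  rw [h.map_ray z hz0, smul_mem_ray_iff hfz] at h2
  linarith

/-- With `u x = 1` and `u y = 0`, translation along `f y` puts `a • f x` and `a⁻¹ • f (x + y)` into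
`φ (halfspace u)`, so `a ≥ 1` and `a⁻¹ ≥ 1`. -/
theorem coeff_eq_one (h : InducesOnRays φ f) (hT : φ ⊤ = ⊤) {x y : Euc n}
    (hxy : LinearIndependent ℝ ![x, y]) {a b : ℝ} (hab : f (x + y) = a • f x + b • f y) :
    a = 1 := by
  have hy0 := (linearIndependent_pair_ne_zero hxy).2
  obtain ⟨u, hx, hy⟩ := exists_clm_pair hxy 1 0
  have hs : u (x + y) = 1 := by rw [map_add, hx, hy, add_zero]
  have h1 := h.add_smul_mem hT hs hy hy0 (-b)
  rw [hab, neg_smul, add_neg_cancel_right] at h1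
  have h2 := h.one_le_of_smul_mem hx h1
  have h3 := h.add_smul_mem hT hx hy hy0 (a⁻¹ * b)
  have ha : 0 < a := by linarith
  have h4 : f x + (a⁻¹ * b) • f y = a⁻¹ • f (x + y) := by
    rw [hab, smul_add, smul_smul, smul_smul, inv_mul_cancel₀ ha.ne', one_smul]
  rw [h4] at h3
  have h5 := h.one_le_of_smul_mem hs h3
  have h6 : a ≤ 1 := by
    rw [← one_div, le_div_iff₀ ha] at h5
    linarith
  linarith

theorem map_add_of_pair (h : InducesOnRays φ f) (hT : φ ⊤ = ⊤) {x y : Euc n}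
    (hxy : LinearIndependent ℝ ![x, y]) : f (x + y) = f x + f y := by
  obtain ⟨hx, hy⟩ := linearIndependent_pair_ne_zero hxy
  have hne : x + y ≠ 0 := by
    intro h0
    have := LinearIndependent.pair_iff.1 hxy 1 1 (by simpa using h0)
    simp at this
  obtain ⟨a, b, -, -, hab⟩ := exists_combo_of_mem_ray_sup_ray (h.pair hxy) (p := f (x + y)) (by
    rw [← h.map_ray x hx, ← h.map_ray y hy, ← map_sup, h.mem_iff hne]
    exact (ray x ⊔ ray y).add_mem (ray_le_iff.1 le_sup_left) (ray_le_iff.1 le_sup_right))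
  have ha := h.coeff_eq_one hT hxy hab
  have hb := h.coeff_eq_one hT (LinearIndependent.pair_symm_iff.1 hxy) (a := b) (b := a)
    (by rw [add_comm y x, hab, add_comm])
  rw [hab, ha, hb, one_smul, one_smul]

end InducesOnRays

namespace InducesOnRays

variable {φ : LatticeHom (PC n) (PC n)} {f : Euc n → Euc n}

theorem map_add (h : InducesOnRays φ f) (hT : φ ⊤ = ⊤) (hn : 2 ≤ n) (h0 : f 0 = 0) (x y : Euc n) :
    f (x + y) = f x + f y := by
  by_cases hx : x = 0
  · rw [hx, h0, zero_add, zero_add]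
  by_cases hxy : LinearIndependent ℝ ![x, y]
  · exact h.map_add_of_pair hT hxy
  rw [LinearIndependent.pair_iff' hx] at hxy
  push Not at hxy
  obtain ⟨s, rfl⟩ := hxy
  -- For dependent vectors, an auxiliary independent `z` is added and cancelled: both groupings of
  -- `x + s • x + z` use independent pairs only.
  obtain ⟨z, hz⟩ := exists_linearIndependent_pair hn hx
  have hsmul : ∀ c : ℝ, f (c • x + z) = f (c • x) + f z := by
    intro c
    by_cases hc : c = 0
    · rw [hc, zero_smul, h0, zero_add, zero_add]
    · refine h.map_add_of_pair hT ?_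
      rw [LinearIndependent.pair_iff] at hz ⊢
      intro a b hab
      have := hz (a * c) b (by rw [← hab, smul_smul])
      exact ⟨(mul_eq_zero.1 this.1).resolve_right hc, this.2⟩
  have h1 : f (x + (s • x + z)) = f x + f (s • x + z) := by
    refine h.map_add_of_pair hT ?_
    rw [LinearIndependent.pair_iff] at hz ⊢
    intro a b hab
    have := hz (a + b * s) b (by rw [← hab]; module)
    exact ⟨by simpa [this.2] using this.1, this.2⟩
  have h2 := hsmul (1 + s)
  rw [show (1 + s) • x + z = x + (s • x + z) by module, h1, hsmul s, ← add_assoc] at h2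
  rw [show x + s • x = (1 + s) • x by module]
  exact (add_right_cancel h2).symm

theorem exists_pos_smul (h : InducesOnRays φ f) {x : Euc n} (hx : x ≠ 0) {t : ℝ} (ht : 0 < t) :
    ∃ c : ℝ, 0 < c ∧ f (t • x) = c • f x := by
  have htx : t • x ≠ 0 := smul_ne_zero ht.ne' hx
  rcases le_total 1 t with h1 | h1
  · have : f (t • x) ∈ (ray (f x)).carrier := by
      rw [← h.map_ray x hx, h.mem_iff htx, smul_mem_ray_iff hx]
      exact h1
    obtain ⟨c, hc, e⟩ := (mem_ray (h.ne_zero x hx)).1 this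
    exact ⟨c, by linarith, e.symm⟩
  · have : f x ∈ (ray (f (t • x))).carrier := by
      rw [← h.map_ray _ htx, h.mem_iff hx, mem_ray htx]
      exact ⟨t⁻¹, (one_le_inv₀ ht).2 h1, inv_smul_smul₀ ht.ne' x⟩
    obtain ⟨c, hc, e⟩ := (mem_ray (h.ne_zero _ htx)).1 this
    have hc0 : 0 < c := by linarith
    exact ⟨c⁻¹, inv_pos.2 hc0, by rw [← e, inv_smul_smul₀ hc0.ne']⟩

/-- The point map as an additive homomorphism. -/
def addHom (h : InducesOnRays φ f) (hT : φ ⊤ = ⊤) (hn : 2 ≤ n) (h0 : f 0 = 0) : Euc n →+ Euc n where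
  toFun := f
  map_zero' := h0
  map_add' := h.map_add hT hn h0

theorem map_smul (h : InducesOnRays φ f) (hT : φ ⊤ = ⊤) (hn : 2 ≤ n) (h0 : f 0 = 0) (t : ℝ)
    (x : Euc n) : f (t • x) = t • f x := by
  by_cases hx : x = 0
  · rw [hx, smul_zero, h0, smul_zero]
  have hadd := h.map_add hT hn h0
  have hrat : ∀ q : ℚ, f ((q : ℝ) • x) = (q : ℝ) • f x := fun q =>
    map_ratCast_smul (h.addHom hT hn h0) ℝ ℝ q x
  have hfx := h.ne_zero x hx
  have hinj := smul_left_injective ℝ hfx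
  have hline : ∃ c : ℝ, f (t • x) = c • f x := by
    obtain ⟨q, hq⟩ := exists_rat_lt t
    obtain ⟨c, -, hc⟩ := h.exists_pos_smul hx (sub_pos.2 hq)
    refine ⟨c + q, ?_⟩
    rw [add_smul, ← hc, ← hrat, ← hadd, ← add_smul, sub_add_cancel]
  obtain ⟨c, hc⟩ := hline
  rw [hc]
  congr 1
  -- Positive multiples of `x` go to positive multiples of `f x`, so additivity makes `f` monotone
  -- along the line; comparison with rationals fixes the coefficient.
  apply le_antisymm
  · refine le_of_forall_lt_rat_imp_le fun q hq => ?_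
    obtain ⟨d, hd, hd'⟩ := h.exists_pos_smul hx (sub_pos.2 hq)
    have e := hadd ((q - t) • x) (t • x)
    rw [← add_smul, sub_add_cancel, hrat, hd', hc, ← add_smul] at e
    linarith [hinj e]
  · refine le_of_forall_rat_lt_imp_le fun q hq => ?_
    obtain ⟨d, hd, hd'⟩ := h.exists_pos_smul hx (sub_pos.2 hq)
    have e := hadd ((t - q) • x) ((q : ℝ) • x)
    rw [← add_smul, sub_add_cancel, hrat, hd', hc, ← add_smul] at e
    linarith [hinj e]

end InducesOnRays

/-! ### Conclusion and converse. -/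

theorem exists_linear_of_injective (hn : 2 ≤ n) (φ : LatticeHom (PC n) (PC n))
    (hφ : Function.Injective φ) :
    ∃ g : LinearMap.GeneralLinearGroup ℝ (Euc n),
      ∀ K : PC n, (φ K).carrier = (g : Euc n →ₗ[ℝ] Euc n) '' K.carrier := by
  classical
  have hex : ∀ x : Euc n, ∃ p, (x = 0 → p = 0) ∧ (x ≠ 0 → p ≠ 0 ∧ φ (ray x) = ray p) := by
    intro x
    by_cases hx : x = 0
    · exact ⟨0, fun _ => rfl, fun h => absurd hx h⟩
    · obtain ⟨p, hp⟩ := exists_map_ray_eq_ray hn φ hφ hx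
      exact ⟨p, fun h => absurd h hx, fun _ => hp⟩
  choose f hf0 hf using hex
  have h : InducesOnRays φ f := ⟨hφ, map_bot_eq_bot hn φ hφ, fun x hx => (hf x hx).1,
    fun x hx => (hf x hx).2⟩
  have := nontrivial_euc hn
  obtain ⟨x, hx⟩ := exists_ne (0 : Euc n)
  obtain ⟨y, hxy⟩ := exists_linearIndependent_pair hn hx
  have hT := h.map_top hxy
  let F : Euc n →ₗ[ℝ] Euc n :=
    { toFun := f
      map_add' := h.map_add hT hn (hf0 0 rfl)
      map_smul' := h.map_smul hT hn (hf0 0 rfl) }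
  have hinj : Function.Injective F := by
    rw [injective_iff_map_eq_zero]
    intro x hx
    by_contra hx0
    exact h.ne_zero x hx0 hx
  have hmem : ∀ (x : Euc n) (K : PC n), F x ∈ (φ K).carrier ↔ x ∈ K.carrier := by
    intro x K
    by_cases hx : x = 0
    · rw [hx, _root_.map_zero, ← eq_top_iff_zero_mem, ← eq_top_iff_zero_mem]
      exact ⟨fun hK => hφ (hK.trans hT.symm), fun hK => hK ▸ hT⟩
    · exact h.mem_iff hx
  have hsurj : Function.Surjective F := LinearMap.injective_iff_surjective.1 hinj
  refine ⟨LinearMap.GeneralLinearGroup.ofLinearEquiv (LinearEquiv.ofBijective F ⟨hinj, hsurj⟩),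
    fun K => ?_⟩
  ext p
  constructor
  · intro hp
    obtain ⟨x, rfl⟩ := hsurj p
    exact ⟨x, (hmem x K).1 hp, rfl⟩
  · rintro ⟨x, hx, rfl⟩
    exact (hmem x K).2 hx

/-- The preimage of a member of the family under a linear equivalence. -/
noncomputable def comapEquiv (e : Euc n ≃ₗ[ℝ] Euc n) (K : PC n) : PC n :=
  ⟨e ⁻¹' K.carrier, by
    by_cases h0 : (0 : Euc n) ∈ K.carrier
    · exact Or.inr (Or.inr (by rw [K.eq_univ_of_zero_mem h0, Set.preimage_univ]))
    · refine prop_of_zero_notMem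
        (K.isClosed.preimage (LinearMap.continuous_of_finiteDimensional e.toLinearMap))
        (K.convex.linear_preimage e.toLinearMap) (by simpa using h0) fun x hx c hc => ?_
      rw [Set.mem_preimage, _root_.map_smul]
      exact K.smul_mem hx hc⟩

/-- Joins are preserved because `φ` is left adjoint to `comapEquiv e`; neither the convex hull nor
the case distinction at the origin has to be examined. -/
theorem map_inf_sup_of_image (e : Euc n ≃ₗ[ℝ] Euc n) (φ : PC n → PC n)
    (h : ∀ K, (φ K).carrier = e '' K.carrier) (K L : PC n) :
    φ (K ⊓ L) = φ K ⊓ φ L ∧ φ (K ⊔ L) = φ K ⊔ φ L := by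
  have hle : ∀ K N : PC n, φ K ≤ N ↔ K ≤ comapEquiv e N := by
    intro K N
    rw [le_def, h, Set.image_subset_iff]
    exact Iff.rfl
  constructor
  · apply carrier_injective
    have h1 : (φ K ⊓ φ L).carrier = (φ K).carrier ∩ (φ L).carrier := rfl
    have h2 : (K ⊓ L).carrier = K.carrier ∩ L.carrier := rfl
    rw [h, h1, h, h, h2, Set.image_inter e.injective]
  · refine eq_of_forall_ge_iff fun N => ?_
    rw [hle, sup_le_iff, sup_le_iff, hle, hle]

end PC

theorem mainTheorem1 (n : ℕ) (hn : 2 ≤ n) (φ : PC n → PC n) :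
    (∀ K L : PC n, φ (K ⊓ L) = φ K ⊓ φ L ∧ φ (K ⊔ L) = φ K ⊔ φ L) ↔
      ((∃ A : PC n, ∀ K : PC n, φ K = A) ∨
        ∃ g : LinearMap.GeneralLinearGroup ℝ (EuclideanSpace ℝ (Fin n)),
          ∀ K : PC n, (φ K).carrier =
            (g : EuclideanSpace ℝ (Fin n) →ₗ[ℝ] EuclideanSpace ℝ (Fin n)) '' K.carrier) := by
  constructor
  · intro h
    let ψ : LatticeHom (PC n) (PC n) :=
      { toFun := φ
        map_sup' := fun K L => (h K L).2
        map_inf' := fun K L => (h K L).1 }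
    by_cases hconst : ψ ⊥ = ψ ⊤
    · refine Or.inl ⟨ψ ⊥, fun K => le_antisymm ?_ (OrderHomClass.mono ψ bot_le)⟩
      rw [hconst]
      exact OrderHomClass.mono ψ le_top
    · exact Or.inr (PC.exists_linear_of_injective hn ψ (PC.injective_of_ne hn ψ hconst))
  · rintro (⟨A, hA⟩ | ⟨g, hg⟩) K L
    · simp [hA]
    · exact PC.map_inf_sup_of_image (LinearMap.GeneralLinearGroup.toLinearEquiv g) φ hg K L
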